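/- **Setting.** Let $\mathcal S$ be a compact, second countable topological space with a finite Borel measure $ds$ (for instance a compact subset of $\mathbb R^n$ with Lebesgue measure), let $\mathcal A\subset\mathbb R^m$ be compact with Lebesgue measure $da$, and consider the Markov decision process with transition density $p(s'\mid s,a)$, initial density $d_0(s)$, deterministic reward $r(s,a)$ and discount factor $\gamma\in[0,1)$. For a policy with density $\pi(a\mid s)$ let $\mathcal H(\pi(\cdot\mid s))=-\int_{\mathcal A}\pi(a\mid s)\log\pi(a\mid s)\,da$, and for $\alpha\in\mathbb R$ put $$J(\pi)=\mathbb E_\pi\Big[\sum_{t\ge0}\gamma^t\big(r(S_t,A_t)+\alpha\mathcal H(\pi(\cdot\mid S_t))\big)\Big],$$ $$Q_\pi(s,a)=\mathbb E_\pi\Big[\sum_{t\ge0}\gamma^t\big(r(S_t,A_t)+\alpha\gamma\mathcal H(\pi(\cdot\mid S_{t+1}))\big)\,\Big|\,S_0=s,A_0=a\Big],$$ $$d_\pi(B)=\sum_{t\ge0}\gamma^t\,\mathbb P_\pi(S_t\in B)\quad\text{(the unnormalized discounted occupancy measure)},$$ where $S_0\sim d_0$ (in $J$ and $d_\pi$),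 $A_t\sim\pi(\cdot\mid S_t)$ and $S_{t+1}\sim p(\cdot\mid S_t,A_t)$. For $\theta\in\mathbb R^d$ consider the mixture policy $$\pi^m_\theta(a\mid s)=\sum_{k=1}^N\pi^w_\theta(k\mid s)\,\pi^c_\theta(a\mid s,k),$$ where $\pi^w_\theta(\cdot\mid s)$ is a probability vector and each $\pi^c_\theta(\cdot\mid s,k)$ is a probability density on $\mathcal A$. The components are reparameterized: there are a set $\Xi\subset\mathbb R^l$, a probability density $p(\varepsilon)$ on $\Xi$ with respect to Lebesgue measure, and bijections $f_\theta(\cdot\,;s,k):\Xi\to\mathcal A$ such that $f_\theta(\varepsilon;s,k)$ has law $\pi^c_\theta(\cdot\mid s,k)$ when $\varepsilon\sim p$. **Assumptions.** The functions $p(s'\mid s,a)$, $d_0(s)$, $r(s,a)$, $f_\theta(\varepsilon;s,k)$, $f_\theta^{-1}(a;s,k)$, $\pi^w_\theta(k\mid s)$, $\pi^c_\theta(a\mid s,k)$, $p(\varepsilon)$ are jointly continuous in $s,a,s',\theta,\varepsilon$. The first derivatives of $p(s'\mid s,a)$, $r(s,a)$ and $\pi^c_\theta(a\mid s,k)$ in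 $a$ (taken within $\mathcal A$), and of $f_\theta(\varepsilon;s,k)$, $\pi^w_\theta(k\mid s)$ and $\pi^c_\theta(a\mid s,k)$ in $\theta$, exist and are jointly continuous in all variables. Finally $\pi^m_\theta(a\mid s)>0$ for all $\theta$, $s\in\mathcal S$, $a\in\mathcal A$, so that $\log\pi^m_\theta(a\mid s)$ is defined. **Theorem (Entropy-Regularized Marginalized-Reparameterization Policy Gradient Theorem).** Fix $\theta\in\mathbb R^d$. For all $s\in\mathcal S$ and $\varepsilon\in\Xi$ the function $$\theta'\mapsto\sum_{k=1}^N\pi^w_{\theta'}(k\mid s)\Big(Q_{\pi^m_\theta}(s,f_{\theta'}(\varepsilon;s,k))-\alpha\log\pi^m_{\theta'}(f_{\theta'}(\varepsilon;s,k)\mid s)\Big)$$ (in which the policy defining $Q$ is held fixed at $\pi^m_\theta$) is differentiable at $\theta'=\theta$, its gradient there is integrable with respect to $d_{\pi^m_\theta}(ds)\otimes p(\varepsilon)\,d\varepsilon$, the function $\theta'\mapsto J(\pi^m_{\theta'})$ is differentiable at $\theta$, and $$\nabla_\theta J(\pi^m_\theta)=\mathbb E_{s\sim d_{\pi^m_\theta},\,\varepsilon\sim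 p}\Big[\nabla_{\theta'}\sum_{k=1}^N\pi^w_{\theta'}(k\mid s)\Big(Q_{\pi^m_\theta}(s,f_{\theta'}(\varepsilon;s,k))-\alpha\log\pi^m_{\theta'}(f_{\theta'}(\varepsilon;s,k)\mid s)\Big)\Big|_{\theta'=\theta}\Big],$$ where $\mathbb E_{s\sim d_\pi}$ denotes integration against the (unnormalized) measure $d_\pi$. -/

import Mathlib

open MeasureTheory ProbabilityTheory TopologicalSpace
open scoped ENNReal

noncomputable section

namespace MixturePG

/-- `ℝⁿ` with its Euclidean norm. -/
abbrev Eu (n : ℕ) : Type := EuclideanSpace ℝ (Fin n)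

/-- Lebesgue measure on a subset of `ℝⁿ`, viewed as a subtype. -/
def lebesgueOn {n : ℕ} (p : Eu n → Prop) : Measure (Subtype p) :=
  Measure.comap Subtype.val (volume : Measure (Eu n))

/-- Lebesgue measure on a compact action space `A ⊆ ℝᵐ`. -/
def actionMeasure {m : ℕ} (A : Compacts (Eu m)) : Measure A :=
  lebesgueOn fun a => a ∈ A

instance instFiniteActionMeasure {m : ℕ} (A : Compacts (Eu m)) :
    IsFiniteMeasure (actionMeasure A) where
  measure_univ_lt_top := by
    have h : actionMeasure A Set.univ = volume (A : Set (Eu m)) := by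
      have := comap_subtype_coe_apply A.isCompact.measurableSet
        (volume : Measure (Eu m)) Set.univ
      rw [Set.image_univ, Subtype.range_coe_subtype] at this
      exact this
    rw [h]
    exact A.isCompact.measure_lt_top

/-- Lebesgue measure on a noise space `Ξ ⊆ ℝˡ`. -/
def noiseVolume {l : ℕ} (Ξ : Set (Eu l)) : Measure Ξ :=
  lebesgueOn fun ε => ε ∈ Ξ

/-- A Markov decision process with state space `S` (with reference measure `μ`, written `ds` in
integrals), action space `A ⊆ ℝᵐ`, transition density `trans s a s' = p(s' | s, a)`, initial state
density `init = d₀`, deterministic reward `reward = r` and discount factor `disc = γ`. -/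
structure MDP (S : Type*) [MeasurableSpace S] (μ : Measure S) {m : ℕ} (A : Compacts (Eu m)) where
  trans : S → A → S → ℝ
  init : S → ℝ
  reward : S → A → ℝ
  disc : ℝ
  measurable_trans : Measurable fun x : (S × A) × S => trans x.1.1 x.1.2 x.2
  trans_nonneg : ∀ s a s', 0 ≤ trans s a s'
  lintegral_trans : ∀ s a, ∫⁻ s', ENNReal.ofReal (trans s a s') ∂μ = 1
  measurable_init : Measurable init
  init_nonneg : ∀ s, 0 ≤ init s
  lintegral_init : ∫⁻ s, ENNReal.ofReal (init s) ∂μ = 1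
  measurable_reward : Measurable fun x : S × A => reward x.1 x.2
  disc_nonneg : 0 ≤ disc
  disc_lt_one : disc < 1

/-- A stochastic policy, given by its density `dens s a = π(a | s)` with respect to Lebesgue
measure on the action space. -/
structure Policy (S : Type*) [MeasurableSpace S] {m : ℕ} (A : Compacts (Eu m)) where
  dens : S → A → ℝ
  measurable_dens : Measurable fun x : S × A => dens x.1 x.2
  dens_nonneg : ∀ s a, 0 ≤ dens s a
  lintegral_dens : ∀ s, ∫⁻ a, ENNReal.ofReal (dens s a) ∂(actionMeasure A) = 1

section Chain

variable {S : Type*} [MeasurableSpace S] {μ : Measure S} [IsFiniteMeasure μ]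
  {m : ℕ} {A : Compacts (Eu m)}

/-- The law `π(· | s)` on actions, as a kernel. -/
def Policy.kernel (π : Policy S A) : Kernel S A :=
  Kernel.withDensity (Kernel.const S (actionMeasure A)) fun s a => ENNReal.ofReal (π.dens s a)

instance Policy.instMarkovKernel (π : Policy S A) : IsMarkovKernel π.kernel where
  isProbabilityMeasure s := by
    refine ⟨?_⟩
    have h : Measurable (Function.uncurry fun (s : S) (a : A) => ENNReal.ofReal (π.dens s a)) :=
      π.measurable_dens.ennreal_ofReal
    rw [Policy.kernel, Kernel.withDensity_apply' _ h, Measure.restrict_univ, Kernel.const_apply]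
    exact π.lintegral_dens s

/-- Differential entropy `H(π(· | s)) = - ∫ π(a | s) log π(a | s) da`. -/
def Policy.entropy (π : Policy S A) (s : S) : ℝ :=
  -∫ a, π.dens s a * Real.log (π.dens s a) ∂(actionMeasure A)

/-- The law `p(· | s, a)` of the next state, as a kernel. -/
def MDP.transKernel (M : MDP S μ A) : Kernel (S × A) S :=
  Kernel.withDensity (Kernel.const (S × A) μ) fun x s' => ENNReal.ofReal (M.trans x.1 x.2 s')

instance MDP.instMarkovTransKernel (M : MDP S μ A) : IsMarkovKernel M.transKernel where
  isProbabilityMeasure x := by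
    refine ⟨?_⟩
    have h : Measurable
        (Function.uncurry fun (x : S × A) (s' : S) => ENNReal.ofReal (M.trans x.1 x.2 s')) :=
      M.measurable_trans.ennreal_ofReal
    rw [MDP.transKernel, Kernel.withDensity_apply' _ h, Measure.restrict_univ, Kernel.const_apply]
    exact M.lintegral_trans x.1 x.2

/-- The law of the initial state. -/
def MDP.initMeasure (M : MDP S μ A) : Measure S :=
  μ.withDensity fun s => ENNReal.ofReal (M.init s)

instance MDP.instProbInitMeasure (M : MDP S μ A) : IsProbabilityMeasure M.initMeasure := by
  refine ⟨?_⟩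
  rw [MDP.initMeasure, withDensity_apply _ MeasurableSet.univ, Measure.restrict_univ]
  exact M.lintegral_init

/-- One step of the chain of state-action pairs:
`S_{t+1} ∼ p(· | S_t, A_t)` and then `A_{t+1} ∼ π(· | S_{t+1})`. -/
def MDP.step (M : MDP S μ A) (π : Policy S A) : Kernel (S × A) (S × A) :=
  M.transKernel ⊗ₖ (π.kernel.prodMkLeft (S × A))

instance MDP.instMarkovStep (M : MDP S μ A) (π : Policy S A) : IsMarkovKernel (M.step π) := by
  unfold MDP.step
  infer_instance

/-- The conditional law of `(S_{n+1}, A_{n+1})` given the history up to time `n`. -/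
def MDP.histStep (M : MDP S μ A) (π : Policy S A) (n : ℕ) :
    Kernel (Finset.Iic n → S × A) (S × A) :=
  (M.step π).comap (fun h => h ⟨n, Finset.mem_Iic.2 le_rfl⟩) (measurable_pi_apply _)

instance MDP.instMarkovHistStep (M : MDP S μ A) (π : Policy S A) (n : ℕ) :
    IsMarkovKernel (M.histStep π n) := by
  unfold MDP.histStep
  infer_instance

/-- The law of the whole trajectory `(S_t, A_t)_{t ≥ 0}` when the policy `π` is followed and
`(S_0, A_0)` has law `ρ`. -/
def MDP.pathMeasure (M : MDP S μ A) (π : Policy S A) (ρ : Measure (S × A)) :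
    Measure (ℕ → S × A) :=
  Kernel.trajMeasure (X := fun _ => S × A) ρ (M.histStep π)

/-- The law `P_π` of the trajectory with `S_0 ∼ d₀` and `A_0 ∼ π(· | S_0)`. -/
def MDP.law (M : MDP S μ A) (π : Policy S A) : Measure (ℕ → S × A) :=
  M.pathMeasure π (M.initMeasure ⊗ₘ π.kernel)

/-- The entropy-regularized objective
`J(π) = E_π[∑ₜ γᵗ (r(S_t, A_t) + α H(π(· | S_t)))]`. -/
def MDP.objective (M : MDP S μ A) (α : ℝ) (π : Policy S A) : ℝ :=
  ∫ ω, ∑' t : ℕ, M.disc ^ t *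
    (M.reward (ω t).1 (ω t).2 + α * π.entropy (ω t).1) ∂(M.law π)

/-- The soft action-value function
`Q_π(s, a) = E_π[∑ₜ γᵗ (r(S_t, A_t) + α γ H(π(· | S_{t+1}))) | S_0 = s, A_0 = a]`. -/
def MDP.softQ (M : MDP S μ A) (α : ℝ) (π : Policy S A) (s : S) (a : A) : ℝ :=
  ∫ ω, ∑' t : ℕ, M.disc ^ t *
    (M.reward (ω t).1 (ω t).2 + α * M.disc * π.entropy (ω (t + 1)).1)
      ∂(M.pathMeasure π (Measure.dirac (s, a)))

/-- The (unnormalized) discounted occupancy measure `d_π(B) = ∑ₜ γᵗ P_π(S_t ∈ B)`. -/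
def MDP.occupancy (M : MDP S μ A) (π : Policy S A) : Measure S :=
  Measure.sum fun t : ℕ => ENNReal.ofReal (M.disc ^ t) • (M.law π).map fun ω => (ω t).1

end Chain

/-- A mixture policy with `N` components, parameterized by `θ ∈ ℝᵈ`, whose components are
reparameterized through a noise variable `ε ∈ Ξ ⊆ ℝˡ`:
* `weight θ s k = π^w_θ(k | s)`, the weighting policy;
* `comp θ s k a = π^c_θ(a | s, k)`, the density of the `k`-th component policy;
* `noise ε = p(ε)`, the density of the noise;
* `repar θ s k ε = f_θ(ε; s, k)`, an invertible map from the noise space to the action space, with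
  inverse `(repar θ s k).symm a = f_θ⁻¹(a; s, k)`.
The field `map_repar` says that `f_θ(ε; s, k)` has law `π^c_θ(· | s, k)` when `ε ∼ p`. -/
structure MixturePolicy (S : Type*) [MeasurableSpace S] {m : ℕ} (A : Compacts (Eu m))
    {l : ℕ} (Ξ : Set (Eu l)) (d N : ℕ) where
  weight : Eu d → S → Fin N → ℝ
  comp : Eu d → S → Fin N → A → ℝ
  noise : Ξ → ℝ
  repar : Eu d → S → Fin N → Ξ ≃ A
  measurable_weight : ∀ θ k, Measurable fun s => weight θ s k
  weight_nonneg : ∀ θ s k, 0 ≤ weight θ s k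
  sum_weight : ∀ θ s, ∑ k, weight θ s k = 1
  measurable_comp : ∀ θ k, Measurable fun x : S × A => comp θ x.1 k x.2
  comp_nonneg : ∀ θ s k a, 0 ≤ comp θ s k a
  lintegral_comp : ∀ θ s k, ∫⁻ a, ENNReal.ofReal (comp θ s k a) ∂(actionMeasure A) = 1
  measurable_noise : Measurable noise
  noise_nonneg : ∀ ε, 0 ≤ noise ε
  lintegral_noise : ∫⁻ ε, ENNReal.ofReal (noise ε) ∂(noiseVolume Ξ) = 1
  map_repar : ∀ θ s k,
    Measure.map (repar θ s k) ((noiseVolume Ξ).withDensity fun ε => ENNReal.ofReal (noise ε))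
      = (actionMeasure A).withDensity fun a => ENNReal.ofReal (comp θ s k a)

section Mixture

variable {S : Type*} [MeasurableSpace S] {m : ℕ} {A : Compacts (Eu m)} {l : ℕ} {Ξ : Set (Eu l)}
  {d N : ℕ}

/-- The law of the noise `ε ∼ p`. -/
def MixturePolicy.noiseMeasure (P : MixturePolicy S A Ξ d N) : Measure Ξ :=
  (noiseVolume Ξ).withDensity fun ε => ENNReal.ofReal (P.noise ε)

/-- The mixture policy `π^m_θ(a | s) = ∑ₖ π^w_θ(k | s) π^c_θ(a | s, k)`. -/
def MixturePolicy.policy (P : MixturePolicy S A Ξ d N) (θ : Eu d) : Policy S A where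
  dens s a := ∑ k, P.weight θ s k * P.comp θ s k a
  measurable_dens := Finset.measurable_sum _ fun k _ =>
    ((P.measurable_weight θ k).comp measurable_fst).mul (P.measurable_comp θ k)
  dens_nonneg s a := Finset.sum_nonneg fun k _ =>
    mul_nonneg (P.weight_nonneg θ s k) (P.comp_nonneg θ s k a)
  lintegral_dens s := by
    have hm : ∀ k, Measurable fun a : A => ENNReal.ofReal (P.comp θ s k a) := fun k =>
      ((P.measurable_comp θ k).comp measurable_prodMk_left).ennreal_ofReal
    simp_rw [ENNReal.ofReal_sum_of_nonneg fun k _ =>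
      mul_nonneg (P.weight_nonneg θ s k) (P.comp_nonneg θ s k _),
      ENNReal.ofReal_mul (P.weight_nonneg θ s _)]
    rw [lintegral_finsetSum _ fun k _ => (hm k).const_mul _]
    simp_rw [lintegral_const_mul _ (hm _), P.lintegral_comp, mul_one]
    rw [← ENNReal.ofReal_sum_of_nonneg fun k _ => P.weight_nonneg θ s k, P.sum_weight,
      ENNReal.ofReal_one]

end Mixture

/-- `g x θ` has a derivative in the parameter `θ ∈ ℝᵈ` which is jointly continuous in `(x, θ)`. -/
def HasContDerivParam {X F : Type*} [TopologicalSpace X] [NormedAddCommGroup F] [NormedSpace ℝ F]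
    {d : ℕ} (g : X → Eu d → F) : Prop :=
  ∃ D : X → Eu d → (Eu d →L[ℝ] F), (Continuous fun y : X × Eu d => D y.1 y.2) ∧
    ∀ x θ, HasFDerivAt (g x) (D x θ) θ

/-- `g x a` has a derivative in the action `a ∈ A ⊆ ℝᵐ`, taken within the compact set `A`, which is
jointly continuous in `(x, a)`. Here `G` is any extension of `g` off `A`; derivatives within `A` do
not depend on it. -/
def HasContDerivAction {X : Type*} [TopologicalSpace X] {m : ℕ} {A : Compacts (Eu m)}
    (g : X → A → ℝ) : Prop :=
  ∃ (G : X → Eu m → ℝ) (D : X → A → (Eu m →L[ℝ] ℝ)),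
    (∀ x (a : A), G x a = g x a) ∧ (Continuous fun y : X × A => D y.1 y.2) ∧
    ∀ x (a : A), HasFDerivWithinAt (G x) (D x a) (A : Set (Eu m)) a

/-- Regularity of the environment: `p(s' | s, a)`, `d₀(s)`, `r(s, a)` are continuous, and so are the
derivatives of `p` and `r` in the action. -/
structure MDP.Regular {S : Type*} [TopologicalSpace S] [MeasurableSpace S] {μ : Measure S} {m : ℕ}
    {A : Compacts (Eu m)} (M : MDP S μ A) : Prop where
  continuous_trans : Continuous fun x : S × A × S => M.trans x.1 x.2.1 x.2.2
  continuous_init : Continuous M.init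
  continuous_reward : Continuous fun x : S × A => M.reward x.1 x.2
  deriv_trans : HasContDerivAction fun (x : S × S) (a : A) => M.trans x.1 a x.2
  deriv_reward : HasContDerivAction M.reward

/-- Regularity of the policy class: `f_θ(ε; s, k)`, `f_θ⁻¹(a; s, k)`, `π^w_θ(k | s)`,
`π^c_θ(a | s, k)`, `p(ε)` are jointly continuous, and so are the derivatives of `f`, `π^w`, `π^c` in
`θ` and of `π^c` in the action. -/
structure MixturePolicy.Regular {S : Type*} [TopologicalSpace S] [MeasurableSpace S] {m : ℕ}
    {A : Compacts (Eu m)} {l : ℕ} {Ξ : Set (Eu l)} {d N : ℕ} (P : MixturePolicy S A Ξ d N) :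
    Prop where
  continuous_repar : ∀ k, Continuous fun x : Eu d × S × Ξ => P.repar x.1 x.2.1 k x.2.2
  continuous_repar_symm : ∀ k,
    Continuous fun x : Eu d × S × A => (P.repar x.1 x.2.1 k).symm x.2.2
  continuous_weight : ∀ k, Continuous fun x : Eu d × S => P.weight x.1 x.2 k
  continuous_comp : ∀ k, Continuous fun x : Eu d × S × A => P.comp x.1 x.2.1 k x.2.2
  continuous_noise : Continuous P.noise
  deriv_repar : ∀ k, HasContDerivParam fun (x : S × Ξ) θ => (P.repar θ x.1 k x.2 : Eu m)
  deriv_weight : ∀ k, HasContDerivParam fun (s : S) θ => P.weight θ s k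
  deriv_comp_param : ∀ k, HasContDerivParam fun (x : S × A) θ => P.comp θ x.1 k x.2
  deriv_comp_action : ∀ k,
    HasContDerivAction fun (x : Eu d × S) (a : A) => P.comp x.1 x.2 k a

/-- The marginalized integrand
`∑ₖ π^w_θ'(k | s) (Q_{π^m_θ}(s, f_θ'(ε; s, k)) - α log π^m_θ'(f_θ'(ε; s, k) | s))`.
The policy inside the action-value function is the current one, with parameter `θ`; everything else
depends on the variable `θ'` in which the gradient is taken (at `θ' = θ`). -/
def mrpIntegrand {S : Type*} [MeasurableSpace S] {μ : Measure S} [IsFiniteMeasure μ] {m : ℕ}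
    {A : Compacts (Eu m)} {l : ℕ} {Ξ : Set (Eu l)} {d N : ℕ} (M : MDP S μ A)
    (P : MixturePolicy S A Ξ d N) (α : ℝ) (θ : Eu d) (s : S) (ε : Ξ) (θ' : Eu d) : ℝ :=
  ∑ k, P.weight θ' s k *
    (M.softQ α (P.policy θ) s (P.repar θ' s k ε)
      - α * Real.log ((P.policy θ').dens s (P.repar θ' s k ε)))

end MixturePG

end

/-! Write `V_θ` for the soft value function of `π_θ`, `P_θ` for its state transition operator, and
`Φ θ' s` for the average of `mrpIntegrand` over the noise, with `Q` frozen at `θ`. By the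
reparameterization, `Φ θ'` is the soft Bellman operator of `π_θ'` applied to `V_θ`; in particular `Φ
θ = V_θ`. Subtracting this from the Bellman equation of `V_θ'` cancels rewards and entropies, so `u
= V_θ' - V_θ` satisfies `u - γ P_θ' u = Φ θ' - Φ θ` (`softV_sub_integral_mrpIntegrand`).

The right side is `O(‖θ' - θ‖)` uniformly in `s`, and `γ < 1`, hence so is `u`
(`MDP.abs_le_of_bellman`). The occupancy measure inverts `1 - γ P_θ`, so `J(π_θ') - J(π_θ) = ∫ u d
d₀ = ∫ (u - γ P_θ u) d d_π` (`MDP.integral_occupancy_sub`). Replacing `P_θ` by `P_θ'` costs `γ ∫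
(P_θ' - P_θ) u d d_π`, a product of two first-order quantities. Thus `J` and `θ' ↦ ∫ Φ θ' d d_π`
have increments that differ by `O(‖θ' - θ‖²)` (`objective_sub_isBigO`), and it remains to
differentiate the latter under the integral sign.

The differentiability of `θ ↦ V_θ` is never needed, and `V_θ` enters only as a bounded measurable
function: `Q` is smooth in the action because `r` and `p` are. Domination comes from compactness of
`S × Ξ`, where `Ξ` is compact as a continuous image of `A`. -/

noncomputable section

namespace MixturePG

/-! ### Bounded measurable functions and Markov kernels -/

/-- Bounded measurable real functions. -/
structure BddMeasurable {X : Type*} [MeasurableSpace X] (f : X → ℝ) : Prop where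
  measurable : Measurable f
  bdd : ∃ C, ∀ x, |f x| ≤ C

namespace BddMeasurable

variable {X Y : Type*} [MeasurableSpace X] [MeasurableSpace Y] {f g : X → ℝ}

lemma exists_nonneg_bound (hf : BddMeasurable f) : ∃ C, 0 ≤ C ∧ ∀ x, |f x| ≤ C := by
  obtain ⟨C, hC⟩ := hf.bdd
  exact ⟨max C 0, le_max_right _ _, fun x => (hC x).trans (le_max_left _ _)⟩

lemma integrable (hf : BddMeasurable f) (ν : Measure X) [IsFiniteMeasure ν] : Integrable f ν := by
  obtain ⟨C, hC⟩ := hf.bdd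
  exact Integrable.of_bound hf.measurable.aestronglyMeasurable C (.of_forall hC)

lemma add (hf : BddMeasurable f) (hg : BddMeasurable g) : BddMeasurable fun x => f x + g x := by
  obtain ⟨C, hC⟩ := hf.bdd
  obtain ⟨D, hD⟩ := hg.bdd
  exact ⟨hf.measurable.add hg.measurable, C + D, fun x =>
    (abs_add_le _ _).trans (add_le_add (hC x) (hD x))⟩

lemma const_mul (hf : BddMeasurable f) (c : ℝ) : BddMeasurable fun x => c * f x := by
  obtain ⟨C, hC⟩ := hf.bdd
  refine ⟨hf.measurable.const_mul c, |c| * C, fun x => ?_⟩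
  rw [abs_mul]
  exact mul_le_mul_of_nonneg_left (hC x) (abs_nonneg c)

lemma sub (hf : BddMeasurable f) (hg : BddMeasurable g) : BddMeasurable fun x => f x - g x := by
  simpa [sub_eq_add_neg] using hf.add (hg.const_mul (-1))

lemma comp (hf : BddMeasurable f) {φ : Y → X} (hφ : Measurable φ) :
    BddMeasurable fun y => f (φ y) :=
  ⟨hf.measurable.comp hφ, hf.bdd.imp fun _ hC y => hC (φ y)⟩

lemma abs_integral_le {C : ℝ} (hC : ∀ x, |f x| ≤ C) (ν : Measure X) [IsProbabilityMeasure ν] :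
    |∫ x, f x ∂ν| ≤ C := by
  simpa using norm_integral_le_of_norm_le_const (μ := ν) (f := f) (.of_forall hC)

lemma integral_kernel (hf : BddMeasurable f) (κ : Kernel Y X) [IsMarkovKernel κ] :
    BddMeasurable fun y => ∫ x, f x ∂κ y :=
  ⟨hf.measurable.stronglyMeasurable.integral_kernel.measurable,
    hf.bdd.imp fun _ hC y => abs_integral_le hC (κ y)⟩

lemma integral_kernel_prod_right {h : Y × X → ℝ} (hh : BddMeasurable h) (κ : Kernel Y X)
    [IsMarkovKernel κ] : BddMeasurable fun y => ∫ x, h (y, x) ∂κ y :=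
  ⟨(StronglyMeasurable.integral_kernel_prod_right' hh.measurable.stronglyMeasurable).measurable,
    hh.bdd.imp fun _ hC y => abs_integral_le (fun x => hC (y, x)) (κ y)⟩

end BddMeasurable

/-! ### Discounted series -/

section Discounted

variable {X : Type*} [MeasurableSpace X] {γ C : ℝ} {f : ℕ → X → ℝ}

lemma summable_discounted (hγ0 : 0 ≤ γ) (hγ1 : γ < 1) {a : ℕ → ℝ} (ha : ∀ t, |a t| ≤ C) :
    Summable fun t => γ ^ t * a t := by
  refine Summable.of_norm_bounded ((summable_geometric_of_lt_one hγ0 hγ1).mul_right C) fun t => ?_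
  rw [Real.norm_eq_abs, abs_mul, abs_of_nonneg (pow_nonneg hγ0 t)]
  exact mul_le_mul_of_nonneg_left (ha t) (pow_nonneg hγ0 t)

lemma integral_discounted (hγ0 : 0 ≤ γ) (hγ1 : γ < 1) (hf : ∀ t, Measurable (f t))
    (hC : ∀ t x, |f t x| ≤ C) (ν : Measure X) [IsProbabilityMeasure ν] :
    ∫ x, ∑' t, γ ^ t * f t x ∂ν = ∑' t, γ ^ t * ∫ x, f t x ∂ν := by
  have hb : ∀ t, BddMeasurable fun x => γ ^ t * f t x := fun t =>
    BddMeasurable.const_mul ⟨hf t, C, hC t⟩ _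
  rw [← integral_tsum_of_summable_integral_norm (fun t => (hb t).integrable ν)]
  · simp_rw [integral_const_mul]
  · refine Summable.of_nonneg_of_le (fun t => integral_nonneg fun x => norm_nonneg _) (fun t => ?_)
      ((summable_geometric_of_lt_one hγ0 hγ1).mul_right C)
    refine (le_abs_self _).trans (BddMeasurable.abs_integral_le (fun x => ?_) ν)
    rw [abs_norm, Real.norm_eq_abs, abs_mul, abs_of_nonneg (pow_nonneg hγ0 t)]
    exact mul_le_mul_of_nonneg_left (hC t x) (pow_nonneg hγ0 t)

lemma bddMeasurable_discounted (hγ0 : 0 ≤ γ) (hγ1 : γ < 1) (hf : ∀ t, Measurable (f t))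
    (hC : ∀ t x, |f t x| ≤ C) : BddMeasurable fun x => ∑' t, γ ^ t * f t x := by
  refine ⟨?_, ∑' t, γ ^ t * C, fun x => ?_⟩
  · refine measurable_of_tendsto_metrizable (f := fun n x => ∑ t ∈ Finset.range n, γ ^ t * f t x)
      (fun n => Finset.measurable_sum _ fun t _ => (hf t).const_mul _) ?_
    rw [tendsto_pi_nhds]
    exact fun x => (summable_discounted hγ0 hγ1 fun t => hC t x).hasSum.tendsto_sum_nat
  · rw [← Real.norm_eq_abs]
    refine tsum_of_norm_bounded ((summable_geometric_of_lt_one hγ0 hγ1).mul_right C).hasSum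
      fun t => ?_
    rw [Real.norm_eq_abs, abs_mul, abs_of_nonneg (pow_nonneg hγ0 t)]
    exact mul_le_mul_of_nonneg_left (hC t x) (pow_nonneg hγ0 t)

end Discounted

/-! ### The state-action chain and the soft Bellman equations -/

section Chain

variable {S : Type*} [MeasurableSpace S] {μ : Measure S} [IsFiniteMeasure μ]
  {m : ℕ} {A : Compacts (Eu m)} (M : MDP S μ A) (π : Policy S A)

instance MDP.instProbPathMeasure (ρ : Measure (S × A)) [IsProbabilityMeasure ρ] :
    IsProbabilityMeasure (M.pathMeasure π ρ) := by
  unfold MDP.pathMeasure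
  infer_instance

instance MDP.instProbLaw : IsProbabilityMeasure (M.law π) := by
  unfold MDP.law
  infer_instance

lemma Policy.integral_kernel (s : S) (g : A → ℝ) :
    ∫ a, g a ∂π.kernel s = ∫ a, π.dens s a * g a ∂actionMeasure A := by
  have h : Measurable (Function.uncurry fun (s : S) (a : A) => ENNReal.ofReal (π.dens s a)) :=
    π.measurable_dens.ennreal_ofReal
  rw [Policy.kernel, Kernel.withDensity_apply _ h, Kernel.const_apply,
    integral_withDensity_eq_integral_toReal_smul (h.of_uncurry_left)
      (.of_forall fun _ => ENNReal.ofReal_lt_top)]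
  simp [ENNReal.toReal_ofReal (π.dens_nonneg s _)]

lemma MDP.integral_transKernel (x : S × A) (g : S → ℝ) :
    ∫ s', g s' ∂M.transKernel x = ∫ s', M.trans x.1 x.2 s' * g s' ∂μ := by
  have h : Measurable
      (Function.uncurry fun (x : S × A) (s' : S) => ENNReal.ofReal (M.trans x.1 x.2 s')) :=
    M.measurable_trans.ennreal_ofReal
  rw [MDP.transKernel, Kernel.withDensity_apply _ h, Kernel.const_apply,
    integral_withDensity_eq_integral_toReal_smul (h.of_uncurry_left)
      (.of_forall fun _ => ENNReal.ofReal_lt_top)]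
  simp [ENNReal.toReal_ofReal (M.trans_nonneg _ _ _)]

variable {M π}

lemma MDP.integral_step {c : S × A → ℝ} (hc : BddMeasurable c) (x : S × A) :
    ∫ y, c y ∂M.step π x = ∫ s', ∫ a, c (s', a) ∂π.kernel s' ∂M.transKernel x := by
  rw [MDP.step, ProbabilityTheory.integral_compProd]
  · rfl
  · exact hc.integrable _

lemma MDP.integral_path_zero {ρ : Measure (S × A)} [IsProbabilityMeasure ρ] {c : S × A → ℝ}
    (hc : BddMeasurable c) : ∫ ω, c (ω 0) ∂M.pathMeasure π ρ = ∫ x, c x ∂ρ := by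
  have h : (M.pathMeasure π ρ).map (fun ω => ω 0) = ρ := by
    -- The trajectory up to time `0` involves no transition: the partial trajectory kernel from `0`
    -- to `0` is the identity.
    have h1 : (M.pathMeasure π ρ).map (Preorder.frestrictLe 0)
        = ρ.map (MeasurableEquiv.piUnique (fun _ : Finset.Iic 0 => S × A)).symm := by
      rw [MDP.pathMeasure, Kernel.trajMeasure, Measure.map_comp _ _ (by fun_prop),
        Kernel.traj_map_frestrictLe, Kernel.partialTraj_self]
      exact Measure.id_comp
    have h2 : (fun ω : ℕ → S × A => ω 0)
        = (fun h : Finset.Iic 0 → S × A => h ⟨0, by simp⟩) ∘ Preorder.frestrictLe 0 := rfl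
    rw [h2, ← Measure.map_map (by fun_prop) (by fun_prop), h1,
      Measure.map_map (by fun_prop) (by fun_prop)]
    exact Measure.map_id
  conv_rhs => rw [← h]
  rw [integral_map (measurable_pi_apply 0).aemeasurable hc.measurable.aestronglyMeasurable]

/-- The Markov property: the joint law of the history and the next pair is a composition product
with `histStep`, which reads only the last entry of the history. -/
lemma MDP.integral_path_succ {ρ : Measure (S × A)} [IsProbabilityMeasure ρ] {c : S × A → ℝ}
    (hc : BddMeasurable c) (t : ℕ) :
    ∫ ω, c (ω (t + 1)) ∂M.pathMeasure π ρ
      = ∫ ω, ∫ y, c y ∂M.step π (ω t) ∂M.pathMeasure π ρ := by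
  have h := Kernel.map_frestrictLe_trajMeasure_compProd_eq_map_trajMeasure (X := fun _ => S × A)
    (μ₀ := ρ) (κ := M.histStep π) (a := t)
  have hm : Measurable fun p : (Finset.Iic t → S × A) × (S × A) => c p.2 :=
    hc.measurable.comp measurable_snd
  have h1 : ∫ ω, c (ω (t + 1)) ∂M.pathMeasure π ρ
      = ∫ p : (Finset.Iic t → S × A) × (S × A), c p.2
        ∂((M.pathMeasure π ρ).map fun x => (Preorder.frestrictLe t x, x (t + 1))) := by
    rw [integral_map (by fun_prop) hm.aestronglyMeasurable]
  have : IsProbabilityMeasure ((M.pathMeasure π ρ).map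
      (Preorder.frestrictLe (π := fun _ => S × A) t)) :=
    Measure.isProbabilityMeasure_map (by fun_prop)
  rw [h1, MDP.pathMeasure, ← h, Measure.integral_compProd]
  · rw [integral_map (by fun_prop)]
    · rfl
    · exact ((hc.integral_kernel _).measurable).aestronglyMeasurable
  · exact (hc.comp measurable_snd).integrable _

variable (M π) in
/-- The transition operator on functions of state-action pairs. -/
def MDP.stepOp (c : S × A → ℝ) (x : S × A) : ℝ := ∫ y, c y ∂M.step π x

lemma MDP.bddMeasurable_iterate {c : S × A → ℝ} (hc : BddMeasurable c) (t : ℕ) :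
    BddMeasurable ((M.stepOp π)^[t] c) := by
  induction t with
  | zero => exact hc
  | succ t ih =>
    rw [Function.iterate_succ_apply']
    exact ih.integral_kernel _

lemma MDP.abs_iterate_le {c : S × A → ℝ} {C : ℝ} (hC : ∀ x, |c x| ≤ C) (t : ℕ) (x : S × A) :
    |(M.stepOp π)^[t] c x| ≤ C := by
  induction t generalizing x with
  | zero => exact hC x
  | succ t ih =>
    rw [Function.iterate_succ_apply']
    exact BddMeasurable.abs_integral_le ih _

/-- Reduces expectations over trajectories to iterates of one operator, so that path space can be
left behind. -/
lemma MDP.integral_path {ρ : Measure (S × A)} [IsProbabilityMeasure ρ] {c : S × A → ℝ}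
    (hc : BddMeasurable c) (t : ℕ) :
    ∫ ω, c (ω t) ∂M.pathMeasure π ρ = ∫ x, (M.stepOp π)^[t] c x ∂ρ := by
  induction t generalizing c with
  | zero => exact integral_path_zero hc
  | succ t ih =>
    rw [integral_path_succ hc, Function.iterate_succ_apply]
    exact ih (hc.integral_kernel _)

variable (M π) in
/-- The expected discounted sum of `c` along the chain, as a function of the initial pair. -/
def MDP.discSum (c : S × A → ℝ) (x : S × A) : ℝ := ∑' t : ℕ, M.disc ^ t * (M.stepOp π)^[t] c x

lemma MDP.bddMeasurable_discSum {c : S × A → ℝ} (hc : BddMeasurable c) :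
    BddMeasurable (M.discSum π c) := by
  obtain ⟨C, hC⟩ := hc.bdd
  exact bddMeasurable_discounted M.disc_nonneg M.disc_lt_one
    (fun t => (bddMeasurable_iterate hc t).measurable) fun t x => abs_iterate_le hC t x

/-- Split off the term `t = 0`; in the rest, one factor `γ` and one application of the step operator
come out, boundedness allowing the sum and integral to be exchanged. -/
lemma MDP.discSum_eq {c : S × A → ℝ} (hc : BddMeasurable c) (x : S × A) :
    M.discSum π c x = c x + M.disc * ∫ y, M.discSum π c y ∂M.step π x := by
  obtain ⟨C, hC⟩ := hc.bdd
  have hs := summable_discounted M.disc_nonneg M.disc_lt_one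
    fun t => abs_iterate_le (M := M) (π := π) hC t x
  rw [MDP.discSum, hs.tsum_eq_zero_add]
  unfold MDP.discSum
  rw [integral_discounted M.disc_nonneg M.disc_lt_one
    (fun t => (bddMeasurable_iterate hc t).measurable) (fun t x => abs_iterate_le hC t x),
    ← tsum_mul_left]
  simp only [Function.iterate_zero, id, pow_zero, one_mul]
  congr 2 with t
  rw [Function.iterate_succ_apply', pow_succ', mul_assoc]
  rfl

lemma MDP.integral_path_discounted {ρ : Measure (S × A)} [IsProbabilityMeasure ρ] {c : S × A → ℝ}
    (hc : BddMeasurable c) :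
    ∫ ω, ∑' t : ℕ, M.disc ^ t * c (ω t) ∂M.pathMeasure π ρ = ∫ x, M.discSum π c x ∂ρ := by
  obtain ⟨C, hC⟩ := hc.bdd
  rw [integral_discounted (f := fun t (ω : ℕ → S × A) => c (ω t)) M.disc_nonneg M.disc_lt_one
    (fun t => hc.measurable.comp (measurable_pi_apply t)) (fun t ω => hC (ω t))]
  unfold MDP.discSum
  rw [integral_discounted M.disc_nonneg M.disc_lt_one
    (fun t => (bddMeasurable_iterate hc t).measurable) (fun t x => abs_iterate_le hC t x)]
  simp_rw [integral_path hc]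

variable (M π) in
/-- Reward plus entropy bonus. -/
def MDP.softReward (α : ℝ) (x : S × A) : ℝ := M.reward x.1 x.2 + α * π.entropy x.1

variable (M π) in
/-- The soft state-value function. -/
def MDP.softV (α : ℝ) (s : S) : ℝ := ∫ a, M.discSum π (M.softReward π α) (s, a) ∂π.kernel s

variable {α : ℝ}

lemma MDP.bddMeasurable_softV (hc : BddMeasurable (M.softReward π α)) :
    BddMeasurable (M.softV π α) :=
  (bddMeasurable_discSum hc).integral_kernel_prod_right _

lemma MDP.discSum_softReward (hc : BddMeasurable (M.softReward π α)) (s : S) (a : A) :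
    M.discSum π (M.softReward π α) (s, a) = M.reward s a + α * π.entropy s
      + M.disc * ∫ s', M.trans s a s' * M.softV π α s' ∂μ := by
  rw [discSum_eq hc, integral_step (bddMeasurable_discSum hc), integral_transKernel]
  rfl

/-- The factor `γ` in front of the entropy at time `t + 1` makes the entropy series the full
discounted one with its term `t = 0` removed. Hence `Q` is `discSum` of `softReward` minus `α` times
the entropy at the starting state, which cancels the entropy term in `discSum_softReward`. -/
lemma MDP.softQ_eq (hr : BddMeasurable fun x : S × A => M.reward x.1 x.2)
    (hH : BddMeasurable π.entropy) (s : S) (a : A) :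
    M.softQ α π s a = M.reward s a + M.disc * ∫ s', M.trans s a s' * M.softV π α s' ∂μ := by
  have hH' : BddMeasurable fun x : S × A => π.entropy x.1 := hH.comp measurable_fst
  have hc : BddMeasurable (M.softReward π α) := hr.add (hH'.const_mul α)
  obtain ⟨C, hC⟩ := hr.bdd
  obtain ⟨D, hD⟩ := hH.bdd
  have key : ∀ ω : ℕ → S × A, ∑' t : ℕ, M.disc ^ t *
      (M.reward (ω t).1 (ω t).2 + α * M.disc * π.entropy (ω (t + 1)).1)
      = ∑' t : ℕ, M.disc ^ t * M.softReward π α (ω t) - α * π.entropy (ω 0).1 := fun ω => by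
    have h1 : Summable fun t => M.disc ^ t * M.reward (ω t).1 (ω t).2 :=
      summable_discounted M.disc_nonneg M.disc_lt_one fun t => hC (ω t)
    have h2 : Summable fun t => M.disc ^ t * π.entropy (ω t).1 :=
      summable_discounted M.disc_nonneg M.disc_lt_one fun t => hD (ω t).1
    have h3 : Summable fun t => α * (M.disc ^ (t + 1) * π.entropy (ω (t + 1)).1) :=
      ((summable_nat_add_iff 1).2 h2).mul_left α
    have e1 : ∀ t, M.disc ^ t * (M.reward (ω t).1 (ω t).2
        + α * M.disc * π.entropy (ω (t + 1)).1) = M.disc ^ t * M.reward (ω t).1 (ω t).2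
        + α * (M.disc ^ (t + 1) * π.entropy (ω (t + 1)).1) := fun t => by ring
    have e2 : ∀ t, M.disc ^ t * M.softReward π α (ω t) = M.disc ^ t * M.reward (ω t).1 (ω t).2
        + α * (M.disc ^ t * π.entropy (ω t).1) := fun t => by rw [softReward]; ring
    simp_rw [e1, e2]
    rw [h1.tsum_add h3, h1.tsum_add (h2.mul_left α), tsum_mul_left, tsum_mul_left,
      h2.tsum_eq_zero_add]
    simp
    ring
  obtain ⟨E, hE⟩ := hc.bdd
  have hint : BddMeasurable fun ω : ℕ → S × A => ∑' t : ℕ, M.disc ^ t * M.softReward π α (ω t) :=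
    bddMeasurable_discounted M.disc_nonneg M.disc_lt_one
      (fun t => hc.measurable.comp (measurable_pi_apply t)) fun t ω => hE (ω t)
  rw [MDP.softQ]
  simp_rw [key]
  rw [integral_sub (hint.integrable _)
    (((hH'.const_mul α).comp (measurable_pi_apply 0)).integrable _),
    integral_path_discounted hc, integral_path_zero (c := fun x => α * π.entropy x.1)
      (hH'.const_mul α)]
  rw [integral_dirac' _ _ (bddMeasurable_discSum hc).measurable.stronglyMeasurable,
    integral_dirac' _ _ (hH'.const_mul α).measurable.stronglyMeasurable, discSum_softReward hc]
  ring

lemma MDP.objective_eq (hc : BddMeasurable (M.softReward π α)) :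
    M.objective α π = ∫ s, M.softV π α s ∂M.initMeasure := by
  rw [MDP.objective, MDP.law]
  exact (integral_path_discounted hc).trans
    (Measure.integral_compProd ((bddMeasurable_discSum hc).integrable _))

lemma MDP.softV_eq (hr : BddMeasurable fun x : S × A => M.reward x.1 x.2)
    (hH : BddMeasurable π.entropy) (s : S) :
    M.softV π α s = ∫ a, (M.reward s a + M.disc * ∫ s', M.trans s a s' * M.softV π α s' ∂μ)
      ∂π.kernel s + α * π.entropy s := by
  have hc : BddMeasurable (M.softReward π α) := hr.add ((hH.comp measurable_fst).const_mul α)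
  have hV := (bddMeasurable_softV hc).integral_kernel M.transKernel
  simp_rw [integral_transKernel] at hV
  conv_lhs => rw [MDP.softV]
  simp_rw [discSum_softReward hc]
  have h1 : BddMeasurable fun a => M.reward s a :=
    hr.comp (φ := fun a => (s, a)) measurable_prodMk_left
  have h2 : BddMeasurable fun a => ∫ s', M.trans s a s' * M.softV π α s' ∂μ :=
    hV.comp (φ := fun a => (s, a)) measurable_prodMk_left
  have e : ∀ a, M.reward s a + α * π.entropy s
      + M.disc * ∫ s', M.trans s a s' * M.softV π α s' ∂μ
      = (M.reward s a + M.disc * ∫ s', M.trans s a s' * M.softV π α s' ∂μ)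
        + α * π.entropy s := fun a => by ring
  simp_rw [e]
  rw [integral_add ((h1.add (h2.const_mul _)).integrable _) (integrable_const _)]
  simp

/-! ### State marginals and the occupancy measure -/

variable (M π) in
/-- The state transition operator under `π`. -/
def MDP.stateOp (u : S → ℝ) (s : S) : ℝ := ∫ a, ∫ s', u s' ∂M.transKernel (s, a) ∂π.kernel s

lemma MDP.bddMeasurable_stateOp {u : S → ℝ} (hu : BddMeasurable u) :
    BddMeasurable (M.stateOp π u) :=
  (hu.integral_kernel M.transKernel).integral_kernel_prod_right _

lemma MDP.abs_stateOp_le {u : S → ℝ} {C : ℝ} (hC : ∀ s, |u s| ≤ C) (s : S) :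
    |M.stateOp π u s| ≤ C :=
  BddMeasurable.abs_integral_le (fun _ => BddMeasurable.abs_integral_le hC _) _

/-- Given `S_t`, the action `A_t` has law `π(· | S_t)`: at time `0` by the choice of initial law,
later because every step ends by drawing from `π`. This makes the state process Markov with operator
`stateOp`. -/
lemma MDP.integral_law_marginal {h : S × A → ℝ} (hh : BddMeasurable h) (t : ℕ) :
    ∫ ω, h (ω t) ∂M.law π = ∫ ω, ∫ a, h ((ω t).1, a) ∂π.kernel (ω t).1 ∂M.law π := by
  have hh' : BddMeasurable fun x : S × A => ∫ a, h (x.1, a) ∂π.kernel x.1 :=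
    (hh.integral_kernel_prod_right π.kernel).comp measurable_fst
  rw [MDP.law]
  cases t with
  | zero =>
    rw [integral_path_zero hh, integral_path_zero (c := fun x => ∫ a, h (x.1, a) ∂π.kernel x.1) hh',
      Measure.integral_compProd (hh.integrable _), Measure.integral_compProd (hh'.integrable _)]
    simp
  | succ t =>
    rw [integral_path_succ hh,
      integral_path_succ (c := fun x => ∫ a, h (x.1, a) ∂π.kernel x.1) hh']
    simp_rw [integral_step hh, integral_step hh']
    simp

lemma MDP.integral_law_succ {u : S → ℝ} (hu : BddMeasurable u) (t : ℕ) :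
    ∫ ω, u (ω (t + 1)).1 ∂M.law π = ∫ ω, M.stateOp π u (ω t).1 ∂M.law π := by
  have h1 : BddMeasurable fun x : S × A => u x.1 := hu.comp measurable_fst
  have h2 := integral_path_succ (M := M) (π := π) (ρ := M.initMeasure ⊗ₘ π.kernel) h1 t
  rw [MDP.law, h2]
  simp_rw [integral_step h1]
  simp only [integral_const, probReal_univ, one_smul]
  exact integral_law_marginal (hu.integral_kernel M.transKernel) t

lemma MDP.occupancy_univ_lt_top : M.occupancy π Set.univ < ∞ := by
  rw [MDP.occupancy, Measure.sum_apply _ MeasurableSet.univ]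
  have : ∀ t : ℕ, (ENNReal.ofReal (M.disc ^ t) • (M.law π).map fun ω => (ω t).1) Set.univ
      = ENNReal.ofReal (M.disc ^ t) := fun t => by
    rw [Measure.smul_apply, Measure.map_apply (by fun_prop) MeasurableSet.univ]
    simp
  simp_rw [this]
  rw [← ENNReal.ofReal_tsum_of_nonneg (fun t => pow_nonneg M.disc_nonneg t)
    (summable_geometric_of_lt_one M.disc_nonneg M.disc_lt_one)]
  exact ENNReal.ofReal_lt_top

instance MDP.instFiniteOccupancy : IsFiniteMeasure (M.occupancy π) := ⟨occupancy_univ_lt_top⟩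

lemma MDP.integral_occupancy {u : S → ℝ} (hu : BddMeasurable u) :
    ∫ s, u s ∂M.occupancy π = ∑' t : ℕ, M.disc ^ t * ∫ ω, u (ω t).1 ∂M.law π := by
  have h := hu.integrable (M.occupancy π)
  rw [MDP.occupancy] at h ⊢
  rw [integral_sum_measure h]
  congr 1 with t
  rw [integral_smul_measure, ENNReal.toReal_ofReal (pow_nonneg M.disc_nonneg t),
    integral_map (measurable_pi_apply t).fst.aemeasurable hu.measurable.aestronglyMeasurable, smul_eq_mul]

/-- The occupancy measure inverts the Bellman operator: `∫ (u - γ P_π u) d d_π = ∫ u d d₀`. -/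
lemma MDP.integral_occupancy_sub {u : S → ℝ} (hu : BddMeasurable u) :
    ∫ s, (u s - M.disc * M.stateOp π u s) ∂M.occupancy π = ∫ s, u s ∂M.initMeasure := by
  obtain ⟨C, hC⟩ := hu.bdd
  have hs : Summable fun t : ℕ => M.disc ^ t * ∫ ω, u (ω t).1 ∂M.law π :=
    summable_discounted M.disc_nonneg M.disc_lt_one
      fun t => BddMeasurable.abs_integral_le (f := fun ω : ℕ → S × A => u (ω t).1)
        (fun ω => hC (ω t).1) _
  have h0 : ∫ ω, u (ω 0).1 ∂M.law π = ∫ s, u s ∂M.initMeasure := by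
    have h1 : BddMeasurable fun x : S × A => u x.1 := hu.comp measurable_fst
    rw [MDP.law, integral_path_zero h1, Measure.integral_compProd (h1.integrable _)]
    simp
  -- By `integral_law_succ` the series for `γ P_π u` is the series for `u` from `t = 1` on; only the
  -- term `t = 0` survives.
  rw [integral_sub (hu.integrable _) (((bddMeasurable_stateOp hu).const_mul _).integrable _),
    integral_const_mul, integral_occupancy hu, integral_occupancy (bddMeasurable_stateOp hu),
    hs.tsum_eq_zero_add, ← tsum_mul_left]
  simp_rw [integral_law_succ hu, h0, pow_succ', mul_assoc]
  simp

end Chain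

/-! ### Calculus of jointly C¹ families and differentiation under the integral -/

/-- `g x θ` is jointly continuous and has a jointly continuous derivative in `θ`. -/
structure JointC1 {X F : Type*} [TopologicalSpace X] [NormedAddCommGroup F] [NormedSpace ℝ F]
    {d : ℕ} (g : X → Eu d → F) : Prop where
  continuous : Continuous fun y : X × Eu d => g y.1 y.2
  deriv : HasContDerivParam g

namespace JointC1

variable {X Y : Type*} [TopologicalSpace X] [TopologicalSpace Y] {d : ℕ}

lemma comp {F : Type*} [NormedAddCommGroup F] [NormedSpace ℝ F] {g : X → Eu d → F}
    (hg : JointC1 g) {φ : Y → X} (hφ : Continuous φ) : JointC1 fun y θ => g (φ y) θ := by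
  obtain ⟨hc, D, hD, hd⟩ := hg
  exact ⟨hc.comp (by fun_prop : Continuous fun y : Y × Eu d => (φ y.1, y.2)),
    fun y θ => D (φ y) θ, hD.comp (by fun_prop : Continuous fun y : Y × Eu d => (φ y.1, y.2)),
    fun y θ => hd (φ y) θ⟩

lemma of_const {g : X → ℝ} (hg : Continuous g) : JointC1 fun x (_ : Eu d) => g x :=
  ⟨hg.comp continuous_fst, fun _ _ => 0, continuous_const, fun _ _ => hasFDerivAt_const _ _⟩

variable {g h : X → Eu d → ℝ}

lemma differentiableAt (hg : JointC1 g) (x : X) (θ : Eu d) : DifferentiableAt ℝ (g x) θ := by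
  obtain ⟨-, D, -, hd⟩ := hg
  exact (hd x θ).differentiableAt

lemma continuous_fderiv (hg : JointC1 g) :
    Continuous fun y : X × Eu d => fderiv ℝ (g y.1) y.2 := by
  obtain ⟨-, D, hD, hd⟩ := hg
  simpa only [(hd _ _).fderiv] using hD

lemma add (hg : JointC1 g) (hh : JointC1 h) : JointC1 fun x θ => g x θ + h x θ := by
  obtain ⟨hgc, D, hD, hd⟩ := hg
  obtain ⟨hhc, E, hE, he⟩ := hh
  exact ⟨hgc.add hhc, fun x θ => D x θ + E x θ, hD.add hE, fun x θ => (hd x θ).add (he x θ)⟩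

lemma mul (hg : JointC1 g) (hh : JointC1 h) : JointC1 fun x θ => g x θ * h x θ := by
  obtain ⟨hgc, D, hD, hd⟩ := hg
  obtain ⟨hhc, E, hE, he⟩ := hh
  exact ⟨hgc.mul hhc, fun x θ => g x θ • E x θ + h x θ • D x θ,
    (hgc.smul hE).add (hhc.smul hD), fun x θ => (hd x θ).mul (he x θ)⟩

lemma const_mul (hg : JointC1 g) (c : ℝ) : JointC1 fun x θ => c * g x θ :=
  (of_const continuous_const).mul hg

lemma sub (hg : JointC1 g) (hh : JointC1 h) : JointC1 fun x θ => g x θ - h x θ := by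
  simpa [sub_eq_add_neg] using hg.add (hh.const_mul (-1))

lemma sum {ι : Type*} (s : Finset ι) {f : ι → X → Eu d → ℝ} (hf : ∀ i ∈ s, JointC1 (f i)) :
    JointC1 fun x θ => ∑ i ∈ s, f i x θ := by
  classical
  induction s using Finset.induction_on with
  | empty => simpa using of_const (X := X) (d := d) (continuous_const (y := (0 : ℝ)))
  | insert i s hi ih =>
    simp only [Finset.sum_insert hi]
    exact (hf i (Finset.mem_insert_self i s)).add
      (ih fun j hj => hf j (Finset.mem_insert_of_mem hj))

lemma log (hg : JointC1 g) (hpos : ∀ x θ, 0 < g x θ) : JointC1 fun x θ => Real.log (g x θ) := by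
  obtain ⟨hgc, D, hD, hd⟩ := hg
  exact ⟨hgc.log fun y => (hpos y.1 y.2).ne', fun x θ => (g x θ)⁻¹ • D x θ,
    (hgc.inv₀ fun y => (hpos y.1 y.2).ne').smul hD, fun x θ => (hd x θ).log (hpos x θ).ne'⟩

/-- Locally uniform bounds over a compact parameter space. -/
lemma exists_bound [CompactSpace X] {F : Type*} [NormedAddCommGroup F] {g : X → Eu d → F}
    (hg : Continuous fun y : X × Eu d => g y.1 y.2) (θ : Eu d) :
    ∃ C, 0 ≤ C ∧ ∀ x, ∀ θ' ∈ Metric.ball θ 1, ‖g x θ'‖ ≤ C := by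
  obtain ⟨C, hC⟩ := (isCompact_univ.prod (isCompact_closedBall θ 1)).exists_bound_of_continuousOn
    (f := fun y : X × Eu d => g y.1 y.2) hg.continuousOn
  exact ⟨max C 0, le_max_right _ _, fun x θ' h => (hC (x, θ')
    ⟨Set.mem_univ x, Metric.ball_subset_closedBall h⟩).trans (le_max_left _ _)⟩

/-- The mean value inequality on a convex ball, with a derivative bound uniform in `x` by
compactness. -/
lemma exists_lipschitz [CompactSpace X] (hg : JointC1 g) (θ : Eu d) :
    ∃ C, 0 ≤ C ∧ ∀ x, ∀ θ' ∈ Metric.ball θ 1, |g x θ' - g x θ| ≤ C * ‖θ' - θ‖ := by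
  obtain ⟨C, hC0, hC⟩ := exists_bound (g := fun x θ => fderiv ℝ (g x) θ) hg.continuous_fderiv θ
  refine ⟨C, hC0, fun x θ' h => ?_⟩
  exact (convex_ball θ 1).norm_image_sub_le_of_norm_fderiv_le
    (fun y _ => hg.differentiableAt x y) (fun y hy => hC x y hy) (Metric.mem_ball_self one_pos) h

/-- Chain rule for a function of the parameter and of an action depending on the parameter. -/
lemma comp_action {m : ℕ} {A : Compacts (Eu m)} {g : X → Eu d → A → ℝ} {f : X → Eu d → A}
    (hgc : Continuous fun y : (X × Eu d) × A => g y.1.1 y.1.2 y.2)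
    (hgθ : HasContDerivParam fun (y : X × A) θ => g y.1 θ y.2)
    (hga : HasContDerivAction fun (y : X × Eu d) a => g y.1 y.2 a)
    (hf : JointC1 fun x θ => (f x θ : Eu m)) : JointC1 fun x θ => g x θ (f x θ) := by
  obtain ⟨hfc, F, hF, hFd⟩ := hf
  obtain ⟨D, hD, hDd⟩ := hgθ
  obtain ⟨G, E, hG, hE, hEd⟩ := hga
  have hfc' : Continuous fun y : X × Eu d => f y.1 y.2 := continuous_induced_rng.2 hfc
  refine ⟨hgc.comp (by fun_prop : Continuous fun y : X × Eu d => (y, f y.1 y.2)),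
    fun x θ => D (x, f x θ) θ + (E (x, θ) (f x θ)).comp (F x θ), ?_, fun x θ => ?_⟩
  · refine Continuous.add ?_ (Continuous.clm_comp ?_ hF)
    · exact hD.comp
        (by fun_prop : Continuous fun y : X × Eu d => (((y.1, f y.1 y.2), y.2) : (X × A) × Eu d))
    · exact hE.comp
        (by fun_prop : Continuous fun y : X × Eu d => ((y, f y.1 y.2) : (X × Eu d) × A))
  · have h2 : HasFDerivAt (fun θ' => g x θ (f x θ')) ((E (x, θ) (f x θ)).comp (F x θ)) θ := by
      have := (hEd (x, θ) (f x θ)).comp_hasFDerivAt θ (hFd x θ) (.of_forall fun θ' => (f x θ').2)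
      simpa only [Function.comp_def, hG] using this
    -- Here the action moves together with the parameter, so differentiability at the fixed action
    -- `f x θ` is not enough. The mean value inequality is applied at each fixed action `f x (θ +
    -- v)`, and joint continuity keeps the derivative within `c` of `D (x, f x θ) θ`.
    have h1 : HasFDerivAt (fun θ' => g x θ' (f x θ') - g x θ (f x θ')) (D (x, f x θ) θ) θ := by
      rw [hasFDerivAt_iff_isLittleO_nhds_zero]
      rw [Asymptotics.isLittleO_iff]
      intro c hc
      have hcont : ContinuousAt (fun y : Eu d × Eu d => D (x, f x y.1) y.2) (θ, θ) := by
        refine (hD.comp (?_ : Continuous fun y : Eu d × Eu d =>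
          (((x, f x y.1), y.2) : (X × A) × Eu d))).continuousAt
        have : Continuous fun y : Eu d × Eu d => f x y.1 :=
          hfc'.comp (by fun_prop : Continuous fun y : Eu d × Eu d => (x, y.1))
        fun_prop
      obtain ⟨δ, hδ, hball⟩ := Metric.continuousAt_iff.1 hcont c hc
      filter_upwards [Metric.ball_mem_nhds (0 : Eu d) hδ] with v hv
      rw [mem_ball_zero_iff] at hv
      have key := (convex_ball θ δ).norm_image_sub_le_of_norm_hasFDerivWithin_le'
        (f := fun θ' => g x θ' (f x (θ + v))) (f' := fun θ' => D (x, f x (θ + v)) θ')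
        (φ := D (x, f x θ) θ) (C := c) (x := θ) (y := θ + v)
        (fun y _ => (hDd (x, f x (θ + v)) y).hasFDerivWithinAt)
        (fun y hy => ?_) (Metric.mem_ball_self hδ) (by simpa using hv)
      · simpa using key
      · rw [← dist_eq_norm]
        refine (hball (x := (θ + v, y)) ?_).le
        rw [Prod.dist_eq, max_lt_iff]
        exact ⟨by simpa using hv, hy⟩
    simpa [Pi.add_def] using h1.add h2

/-- Parametric integrals over a finite measure space, with a bounded weight. -/
lemma integral [CompactSpace X] [FirstCountableTopology X] [CompactSpace Y]
    [SecondCountableTopology Y] [MeasurableSpace Y] [OpensMeasurableSpace Y] {μ : Measure Y}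
    [IsFiniteMeasure μ] {p : X × Y → Eu d → ℝ} (hp : JointC1 p) {V : Y → ℝ}
    (hV : BddMeasurable V) : JointC1 fun x θ => ∫ y, p (x, y) θ * V y ∂μ := by
  obtain ⟨hpc, D, hD, hDd⟩ := hp
  obtain ⟨C, hC0, hC⟩ := hV.exists_nonneg_bound
  have hpy : ∀ x θ, Continuous fun y => p (x, y) θ := fun x θ =>
    hpc.comp (by fun_prop : Continuous fun y : Y => ((x, y), θ))
  have hDy : ∀ x θ, Continuous fun y => D (x, y) θ := fun x θ =>
    hD.comp (by fun_prop : Continuous fun y : Y => ((x, y), θ))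
  have hpm : ∀ x θ, AEStronglyMeasurable (fun y => p (x, y) θ * V y) μ := fun x θ =>
    (hpy x θ).aestronglyMeasurable.mul hV.measurable.aestronglyMeasurable
  have hDm : ∀ x θ, AEStronglyMeasurable (fun y => V y • D (x, y) θ) μ := fun x θ =>
    hV.measurable.aestronglyMeasurable.smul (hDy x θ).aestronglyMeasurable
  have hnear : ∀ z : X × Eu d, ∀ᶠ w : X × Eu d in nhds z, w.2 ∈ Metric.ball z.2 1 := fun z =>
    continuous_snd.continuousAt.eventually (Metric.ball_mem_nhds z.2 one_pos)
  refine ⟨?_, fun x θ => ∫ y, V y • D (x, y) θ ∂μ, ?_, fun x θ => ?_⟩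
  · refine continuous_iff_continuousAt.2 fun z => ?_
    obtain ⟨B, hB0, hB⟩ := exists_bound (g := p) hpc z.2
    refine continuousAt_of_dominated (bound := fun _ => B * C) (.of_forall fun w => hpm w.1 w.2)
      ?_ (integrable_const _) (.of_forall fun y => ?_)
    · filter_upwards [hnear z] with w hw
      refine .of_forall fun y => ?_
      rw [norm_mul]
      exact mul_le_mul (hB _ _ hw) (hC y) (norm_nonneg _) hB0
    · exact ((hpc.comp (by fun_prop : Continuous fun w : X × Eu d => ((w.1, y), w.2))).mul
        continuous_const).continuousAt
  · refine continuous_iff_continuousAt.2 fun z => ?_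
    obtain ⟨B, hB0, hB⟩ := exists_bound (g := D) hD z.2
    refine continuousAt_of_dominated (bound := fun _ => C * B) (.of_forall fun w => hDm w.1 w.2)
      ?_ (integrable_const _) (.of_forall fun y => ?_)
    · filter_upwards [hnear z] with w hw
      refine .of_forall fun y => ?_
      rw [norm_smul]
      exact mul_le_mul (hC y) (hB _ _ hw) (norm_nonneg _) hC0
    · exact ((hD.comp (by fun_prop : Continuous fun w : X × Eu d =>
        ((w.1, y), w.2))).const_smul (V y)).continuousAt
  · obtain ⟨B, hB0, hB⟩ := exists_bound (g := D) hD θ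
    obtain ⟨B', hB'0, hB'⟩ := exists_bound (g := p) hpc θ
    refine hasFDerivAt_integral_of_dominated_of_fderiv_le (bound := fun _ => C * B)
      (F' := fun θ y => V y • D (x, y) θ) (Metric.ball_mem_nhds θ one_pos)
      (.of_forall fun w => hpm x w) ?_ (hDm x θ) (.of_forall fun y θ' hθ' => ?_)
      (integrable_const _) (.of_forall fun y θ' _ => (hDd (x, y) θ').mul_const (V y))
    · refine Integrable.of_bound (hpm x θ) (B' * C) (.of_forall fun y => ?_)
      rw [norm_mul]
      exact mul_le_mul (hB' _ _ (Metric.mem_ball_self one_pos)) (hC y) (norm_nonneg _) hB'0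
    · rw [norm_smul]
      exact mul_le_mul (hC y) (hB _ _ hθ') (norm_nonneg _) hC0

section Gradient

variable [CompactSpace X] [MeasurableSpace X] [OpensMeasurableSpace X]
  (ν : Measure X) [IsFiniteMeasure ν]

lemma integrable_apply (hg : JointC1 g) (θ : Eu d) : Integrable (fun x => g x θ) ν := by
  have hc : Continuous fun x => g x θ :=
    hg.continuous.comp (by fun_prop : Continuous fun x : X => (x, θ))
  obtain ⟨C, -, hC⟩ := exists_bound (g := g) hg.continuous θ
  exact .of_bound hc.aestronglyMeasurable C
    (.of_forall fun x => hC x θ (Metric.mem_ball_self one_pos))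

lemma integrable_gradient (hg : JointC1 g) (θ : Eu d) :
    Integrable (fun x => gradient (g x) θ) ν := by
  have hc : Continuous fun y : X × Eu d => gradient (g y.1) y.2 :=
    (InnerProductSpace.toDual ℝ (Eu d)).symm.continuous.comp hg.continuous_fderiv
  obtain ⟨C, -, hC⟩ := exists_bound (g := fun x θ => gradient (g x) θ) hc θ
  exact .of_bound
    (hc.comp (by fun_prop : Continuous fun x : X => (x, θ))).aestronglyMeasurable C
    (.of_forall fun x => hC x θ (Metric.mem_ball_self one_pos))

lemma hasGradientAt_integral (hg : JointC1 g) (θ : Eu d) :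
    HasGradientAt (fun θ' => ∫ x, g x θ' ∂ν) (∫ x, gradient (g x) θ ∂ν) θ := by
  have hD : ∀ θ', Continuous fun x => fderiv ℝ (g x) θ' := fun θ' =>
    hg.continuous_fderiv.comp (by fun_prop : Continuous fun x : X => (x, θ'))
  obtain ⟨C, -, hC⟩ := exists_bound (g := fun x θ => fderiv ℝ (g x) θ) hg.continuous_fderiv θ
  have h := hasFDerivAt_integral_of_dominated_of_fderiv_le (μ := ν) (bound := fun _ => C)
    (F := fun θ x => g x θ) (F' := fun θ x => fderiv ℝ (g x) θ) (Metric.ball_mem_nhds θ one_pos)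
    (.of_forall fun θ' => (hg.integrable_apply ν θ').aestronglyMeasurable)
    (hg.integrable_apply ν θ) (hD θ).aestronglyMeasurable (.of_forall fun x => hC x)
    (integrable_const _) (.of_forall fun x θ' _ => (hg.differentiableAt x θ').hasFDerivAt)
  -- It remains to pass the Riesz isomorphism through the integral, which is checked by pairing with
  -- each vector `v`.
  have hDi : Integrable (fun x => fderiv ℝ (g x) θ) ν :=
    .of_bound (hD θ).aestronglyMeasurable C
      (.of_forall fun x => hC x θ (Metric.mem_ball_self one_pos))
  suffices e : InnerProductSpace.toDual ℝ (Eu d) (∫ x, gradient (g x) θ ∂ν)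
      = ∫ x, fderiv ℝ (g x) θ ∂ν by
    rw [hasGradientAt_iff_hasFDerivAt, e]
    exact h
  ext v
  rw [InnerProductSpace.toDual_apply_apply, ContinuousLinearMap.integral_apply hDi,
    real_inner_comm, ← integral_inner (hg.integrable_gradient ν θ)]
  refine integral_congr_ae (.of_forall fun x => ?_)
  simp only
  rw [real_inner_comm, gradient, InnerProductSpace.toDual_symm_apply]

end Gradient

end JointC1

lemma BddMeasurable.mul {X : Type*} [MeasurableSpace X] {f g : X → ℝ} (hf : BddMeasurable f)
    (hg : BddMeasurable g) : BddMeasurable fun x => f x * g x := by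
  obtain ⟨C, hC0, hC⟩ := hf.exists_nonneg_bound
  obtain ⟨D, hD⟩ := hg.bdd
  refine ⟨hf.measurable.mul hg.measurable, C * D, fun x => ?_⟩
  rw [abs_mul]
  exact mul_le_mul (hC x) (hD x) (abs_nonneg _) hC0

lemma abs_integral_le_mul {X : Type*} [MeasurableSpace X] {f : X → ℝ} {C : ℝ}
    (hC : ∀ x, |f x| ≤ C) (ν : Measure X) [IsFiniteMeasure ν] :
    |∫ x, f x ∂ν| ≤ C * ν.real Set.univ :=
  norm_integral_le_of_norm_le_const (f := f) (.of_forall hC)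

lemma BddMeasurable.of_continuous {X : Type*} [TopologicalSpace X] [CompactSpace X]
    [MeasurableSpace X] [OpensMeasurableSpace X] {f : X → ℝ} (hf : Continuous f) :
    BddMeasurable f := by
  obtain ⟨C, hC⟩ := isCompact_univ.exists_bound_of_continuousOn hf.continuousOn
  exact ⟨hf.measurable, C, fun x => hC x (Set.mem_univ x)⟩

lemma HasContDerivAction.comp {X Y : Type*} [TopologicalSpace X] [TopologicalSpace Y] {m : ℕ}
    {A : Compacts (Eu m)} {g : X → A → ℝ} (hg : HasContDerivAction g) {φ : Y → X}
    (hφ : Continuous φ) : HasContDerivAction fun y a => g (φ y) a := by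
  obtain ⟨G, D, hG, hD, hd⟩ := hg
  exact ⟨fun y => G (φ y), fun y => D (φ y), fun y => hG (φ y),
    hD.comp (by fun_prop : Continuous fun y : Y × A => (φ y.1, y.2)), fun y => hd (φ y)⟩

/-! ### Perturbation of the Bellman equation -/

section Perturbation

variable {S : Type*} [MeasurableSpace S] {μ : Measure S} [IsFiniteMeasure μ]
  {m : ℕ} {A : Compacts (Eu m)} {M : MDP S μ A} {π π' : Policy S A}

/-- `stateOp` does not increase the supremum norm, so `sup |u| ≤ K + γ sup |u|`; this can be solved
for `sup |u|` because it is finite and `γ < 1`. -/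
lemma MDP.abs_le_of_bellman [Nonempty S] {u : S → ℝ} (hu : BddMeasurable u) {K : ℝ}
    (hK : ∀ s, |u s - M.disc * M.stateOp π u s| ≤ K) (s : S) : |u s| ≤ K / (1 - M.disc) := by
  obtain ⟨C, hC⟩ := hu.bdd
  have hb : BddAbove (Set.range fun s => |u s|) := ⟨C, by rintro _ ⟨s, rfl⟩; exact hC s⟩
  have hle : ∀ s, |u s| ≤ ⨆ s, |u s| := fun s => le_ciSup hb s
  have h1 : ∀ s, |u s| ≤ K + M.disc * ⨆ s, |u s| := fun s => by
    calc |u s| = |(u s - M.disc * M.stateOp π u s) + M.disc * M.stateOp π u s| := by ring_nf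
      _ ≤ |u s - M.disc * M.stateOp π u s| + |M.disc * M.stateOp π u s| := abs_add_le _ _
      _ ≤ _ := by
        rw [abs_mul, abs_of_nonneg M.disc_nonneg]
        exact add_le_add (hK s) (mul_le_mul_of_nonneg_left (abs_stateOp_le hle s) M.disc_nonneg)
  have h2 : (⨆ s, |u s|) ≤ K + M.disc * ⨆ s, |u s| := ciSup_le h1
  rw [le_div_iff₀ (sub_pos.2 M.disc_lt_one)]
  have h3 : (⨆ s, |u s|) * (1 - M.disc) ≤ K := by linarith
  exact (mul_le_mul_of_nonneg_right (hle s) (sub_nonneg.2 M.disc_lt_one.le)).trans h3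

/-- The two operators integrate the same function of the action, bounded by `B`, against two
densities at distance at most `C`; the volume of `A` is the price of integrating. -/
lemma MDP.abs_stateOp_sub_le {u : S → ℝ} (hu : BddMeasurable u) {B C : ℝ} {s : S}
    (hB : ∀ s, |u s| ≤ B) (hπ : BddMeasurable (π.dens s)) (hπ' : BddMeasurable (π'.dens s))
    (hC0 : 0 ≤ C) (hC : ∀ a, |π'.dens s a - π.dens s a| ≤ C) :
    |M.stateOp π' u s - M.stateOp π u s| ≤ C * B * (actionMeasure A).real Set.univ := by
  have hh : BddMeasurable fun a => ∫ s', u s' ∂M.transKernel (s, a) :=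
    (hu.integral_kernel M.transKernel).comp (φ := fun a => (s, a)) measurable_prodMk_left
  rw [stateOp, stateOp, Policy.integral_kernel, Policy.integral_kernel,
    ← integral_sub ((hπ'.mul hh).integrable _) ((hπ.mul hh).integrable _)]
  refine abs_integral_le_mul (fun a => ?_) _
  rw [← sub_mul, abs_mul]
  exact mul_le_mul (hC a) (BddMeasurable.abs_integral_le hB _) (abs_nonneg _) hC0

end Perturbation

/-! ### Regularity of the mixture policy -/

section MixtureRegularity

variable {S : Type*} [TopologicalSpace S] [MeasurableSpace S]
  {m : ℕ} {A : Compacts (Eu m)} {l : ℕ} {Ξ : Set (Eu l)} {d N : ℕ} {P : MixturePolicy S A Ξ d N}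

instance MixturePolicy.instProbNoise {S : Type*} [MeasurableSpace S]
    {P : MixturePolicy S A Ξ d N} : IsProbabilityMeasure P.noiseMeasure := by
  refine ⟨?_⟩
  rw [MixturePolicy.noiseMeasure, withDensity_apply _ MeasurableSet.univ, Measure.restrict_univ]
  exact P.lintegral_noise

lemma MDP.nonempty_state {S : Type*} [MeasurableSpace S] {μ : Measure S} (M : MDP S μ A) :
    Nonempty S :=
  M.initMeasure.nonempty_of_neZero

namespace MixturePolicy.Regular

/-- `Ξ` is the image of the compact set `A` under a continuous inverse `f_θ⁻¹(· ; s, k)`. A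
component `k` exists because an empty sum of weights could not equal `1`. -/
lemma compactSpace_noise [Nonempty S] (hP : P.Regular) : CompactSpace Ξ := by
  let s : S := Classical.arbitrary S
  have hN : Nonempty (Fin N) := by
    by_contra h
    rw [not_nonempty_iff] at h
    simpa using P.sum_weight 0 s
  let k : Fin N := Classical.arbitrary _
  have hc : Continuous fun a : A => (P.repar 0 s k).symm a :=
    (hP.continuous_repar_symm k).comp (by fun_prop : Continuous fun a : A => ((0 : Eu d), s, a))
  refine ⟨?_⟩
  rw [← (P.repar 0 s k).symm.surjective.range_eq]
  exact isCompact_range hc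

lemma jointC1_weight (hP : P.Regular) (k : Fin N) : JointC1 fun s θ => P.weight θ s k :=
  ⟨(hP.continuous_weight k).comp (by fun_prop : Continuous fun y : S × Eu d => (y.2, y.1)),
    hP.deriv_weight k⟩

lemma jointC1_comp (hP : P.Regular) (k : Fin N) :
    JointC1 fun (x : S × A) θ => P.comp θ x.1 k x.2 :=
  ⟨(hP.continuous_comp k).comp
    (by fun_prop : Continuous fun y : (S × A) × Eu d => (y.2, y.1.1, y.1.2)), hP.deriv_comp_param k⟩

lemma jointC1_repar (hP : P.Regular) (k : Fin N) :
    JointC1 fun (x : S × Ξ) θ => (P.repar θ x.1 k x.2 : Eu m) :=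
  ⟨continuous_subtype_val.comp ((hP.continuous_repar k).comp
    (by fun_prop : Continuous fun y : (S × Ξ) × Eu d => (y.2, y.1.1, y.1.2))), hP.deriv_repar k⟩

lemma continuous_repar_noise (hP : P.Regular) (k : Fin N) (θ : Eu d) (s : S) :
    Continuous (P.repar θ s k) :=
  (hP.continuous_repar k).comp (by fun_prop : Continuous fun ε : Ξ => (θ, s, ε))

lemma jointC1_dens (hP : P.Regular) :
    JointC1 fun (x : S × A) θ => (P.policy θ).dens x.1 x.2 :=
  JointC1.sum Finset.univ fun k _ =>
    ((hP.jointC1_weight k).comp continuous_fst).mul (hP.jointC1_comp k)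

lemma jointC1_dens_repar (hP : P.Regular) (k : Fin N) :
    JointC1 fun (x : S × Ξ) θ => (P.policy θ).dens x.1 (P.repar θ x.1 k x.2) := by
  refine JointC1.sum Finset.univ fun j _ => ((hP.jointC1_weight j).comp continuous_fst).mul ?_
  refine JointC1.comp_action (g := fun (x : S × Ξ) θ a => P.comp θ x.1 j a) ?_ ?_ ?_
    (hP.jointC1_repar k)
  · exact (hP.continuous_comp j).comp
      (by fun_prop : Continuous fun y : ((S × Ξ) × Eu d) × A => (y.1.2, y.1.1.1, y.2))
  · exact ((hP.jointC1_comp j).comp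
      (by fun_prop : Continuous fun y : (S × Ξ) × A => (y.1.1, y.2))).deriv
  · exact (hP.deriv_comp_action j).comp
      (by fun_prop : Continuous fun y : (S × Ξ) × Eu d => (y.2, y.1.1))

lemma continuous_dens (hP : P.Regular) (θ : Eu d) :
    Continuous fun x : S × A => (P.policy θ).dens x.1 x.2 :=
  hP.jointC1_dens.continuous.comp (by fun_prop : Continuous fun x : S × A => (x, θ))

end MixturePolicy.Regular

end MixtureRegularity

/-! ### The marginalized integrand and the second-order comparison -/

section Mixture

variable {S : Type*} [TopologicalSpace S] [CompactSpace S]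
  [MeasurableSpace S] [BorelSpace S] {μ : Measure S}
  {m : ℕ} {A : Compacts (Eu m)} {l : ℕ} {Ξ : Set (Eu l)} {d N : ℕ}
  {M : MDP S μ A} {P : MixturePolicy S A Ξ d N} {α : ℝ}

lemma MixturePolicy.Regular.bddMeasurable_entropy (hP : P.Regular) (θ : Eu d) :
    BddMeasurable (P.policy θ).entropy := by
  have hb : BddMeasurable fun x : S × A =>
      (P.policy θ).dens x.1 x.2 * Real.log ((P.policy θ).dens x.1 x.2) :=
    .of_continuous (Real.continuous_mul_log.comp (hP.continuous_dens θ))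
  obtain ⟨C, hC⟩ := hb.bdd
  refine ⟨(hb.measurable.stronglyMeasurable.integral_prod_right'
    (ν := actionMeasure A)).measurable.neg, C * (actionMeasure A).real Set.univ, fun s => ?_⟩
  rw [Policy.entropy, abs_neg]
  exact abs_integral_le_mul (fun a => hC (s, a)) _

lemma MDP.Regular.bddMeasurable_reward {S : Type*} [TopologicalSpace S] [CompactSpace S]
    [MeasurableSpace S] [OpensMeasurableSpace S] {μ : Measure S} {M : MDP S μ A} (hM : M.Regular) :
    BddMeasurable fun x : S × A => M.reward x.1 x.2 :=
  .of_continuous hM.continuous_reward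

lemma bddMeasurable_softReward (hM : M.Regular) (hP : P.Regular) (θ : Eu d) :
    BddMeasurable (M.softReward (P.policy θ) α) :=
  hM.bddMeasurable_reward.add (((hP.bddMeasurable_entropy θ).comp measurable_fst).const_mul α)

variable [IsFiniteMeasure μ]

lemma bddMeasurable_softV (hM : M.Regular) (hP : P.Regular) (θ : Eu d) :
    BddMeasurable (M.softV (P.policy θ) α) :=
  MDP.bddMeasurable_softV (bddMeasurable_softReward hM hP θ)

lemma softQ_policy (hM : M.Regular) (hP : P.Regular) (θ : Eu d) (s : S) (a : A) :
    M.softQ α (P.policy θ) s a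
      = M.reward s a + M.disc * ∫ s', M.trans s a s' * M.softV (P.policy θ) α s' ∂μ :=
  MDP.softQ_eq hM.bddMeasurable_reward (hP.bddMeasurable_entropy θ) s a

lemma bddMeasurable_softQ (hM : M.Regular) (hP : P.Regular) (θ : Eu d) :
    BddMeasurable fun x : S × A => M.softQ α (P.policy θ) x.1 x.2 := by
  simp_rw [softQ_policy hM hP]
  have h := (bddMeasurable_softV (α := α) hM hP θ).integral_kernel M.transKernel
  simp_rw [MDP.integral_transKernel] at h
  exact hM.bddMeasurable_reward.add (h.const_mul _)

/-- Integrating the marginalized integrand over the noise gives one application of the soft Bellman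
operator of `π_θ'` to the value function of `π_θ`. -/
lemma integral_mrpIntegrand (hM : M.Regular) (hP : P.Regular)
    (hpos : ∀ θ s a, 0 < (P.policy θ).dens s a) (θ θ' : Eu d) (s : S) :
    ∫ ε, mrpIntegrand M P α θ s ε θ' ∂P.noiseMeasure
      = ∫ a, M.softQ α (P.policy θ) s a ∂(P.policy θ').kernel s + α * (P.policy θ').entropy s := by
  have hQ : BddMeasurable fun a => M.softQ α (P.policy θ) s a :=
    (bddMeasurable_softQ hM hP θ).comp (φ := fun a => (s, a)) measurable_prodMk_left
  have hdc : Continuous fun a => (P.policy θ').dens s a :=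
    (hP.continuous_dens θ').comp (by fun_prop : Continuous fun a : A => (s, a))
  have hL : BddMeasurable fun a => Real.log ((P.policy θ').dens s a) :=
    .of_continuous (hdc.log fun a => (hpos θ' s a).ne')
  have hd : BddMeasurable fun a => (P.policy θ').dens s a := .of_continuous hdc
  set h : A → ℝ := fun a => M.softQ α (P.policy θ) s a
    - α * Real.log ((P.policy θ').dens s a) with h_def
  have hh : BddMeasurable h := hQ.sub (hL.const_mul α)
  have hrep : ∀ k, Measurable (P.repar θ' s k) := fun k =>
    (hP.continuous_repar_noise k θ' s).measurable
  have hcc : ∀ k, Continuous fun a => P.comp θ' s k a := fun k =>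
    (hP.continuous_comp k).comp (by fun_prop : Continuous fun a : A => (θ', s, a))
  -- The function `h` of the action is the same for all components, so after the change of variables
  -- the weighted component densities add up to the mixture density.
  have hk : ∀ k, ∫ ε, h (P.repar θ' s k ε) ∂P.noiseMeasure
      = ∫ a, P.comp θ' s k a * h a ∂actionMeasure A := fun k => by
    rw [← integral_map (hrep k).aemeasurable hh.measurable.aestronglyMeasurable,
      MixturePolicy.noiseMeasure, P.map_repar,
      integral_withDensity_eq_integral_toReal_smul (hcc k).measurable.ennreal_ofReal
        (.of_forall fun _ => ENNReal.ofReal_lt_top)]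
    simp [ENNReal.toReal_ofReal (P.comp_nonneg _ _ _ _)]
  calc ∫ ε, mrpIntegrand M P α θ s ε θ' ∂P.noiseMeasure
      = ∑ k, P.weight θ' s k * ∫ ε, h (P.repar θ' s k ε) ∂P.noiseMeasure := by
        unfold mrpIntegrand
        rw [integral_finsetSum _ fun k _ => ((hh.comp (hrep k)).const_mul _).integrable _]
        simp_rw [integral_const_mul]
    _ = ∫ a, (P.policy θ').dens s a * h a ∂actionMeasure A := by
        simp_rw [hk, ← integral_const_mul]
        rw [← integral_finsetSum _ fun k _ =>
          (((BddMeasurable.of_continuous (hcc k)).mul hh).const_mul _).integrable _]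
        simp_rw [MixturePolicy.policy, Finset.sum_mul, mul_assoc]
    _ = _ := by
        have e : ∀ a, (P.policy θ').dens s a * h a
            = (P.policy θ').dens s a * M.softQ α (P.policy θ) s a
              - α * ((P.policy θ').dens s a * Real.log ((P.policy θ').dens s a)) := fun a => by
          rw [h_def]; ring
        simp_rw [e]
        rw [integral_sub ((hd.mul hQ).integrable _) (((hd.mul hL).const_mul _).integrable _),
          integral_const_mul, Policy.integral_kernel, Policy.entropy]
        ring

/-- Both terms on the left are soft Bellman operators of the same policy `π_θ'`, applied to `V_θ'`
and to `V_θ`. Rewards and entropies cancel, leaving the discounted transition of the difference. -/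
lemma softV_sub_integral_mrpIntegrand (hM : M.Regular) (hP : P.Regular)
    (hpos : ∀ θ s a, 0 < (P.policy θ).dens s a) (θ θ' : Eu d) (s : S) :
    M.softV (P.policy θ') α s - ∫ ε, mrpIntegrand M P α θ s ε θ' ∂P.noiseMeasure
      = M.disc * M.stateOp (P.policy θ')
        (fun s => M.softV (P.policy θ') α s - M.softV (P.policy θ) α s) s := by
  have hQ : ∀ θ, Integrable (fun a => M.softQ α (P.policy θ) s a) ((P.policy θ').kernel s) :=
    fun θ => ((bddMeasurable_softQ hM hP θ).comp (φ := fun a => (s, a))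
      measurable_prodMk_left).integrable _
  have hV : M.softV (P.policy θ') α s = ∫ a, M.softQ α (P.policy θ') s a ∂(P.policy θ').kernel s
      + α * (P.policy θ').entropy s := by
    simp_rw [softQ_policy hM hP]
    exact MDP.softV_eq hM.bddMeasurable_reward (hP.bddMeasurable_entropy θ') s
  rw [hV, integral_mrpIntegrand hM hP hpos, add_sub_add_right_eq_sub, ← integral_sub (hQ _) (hQ _),
    MDP.stateOp, ← integral_const_mul]
  congr 1 with a
  rw [softQ_policy hM hP, softQ_policy hM hP,
    integral_sub ((bddMeasurable_softV hM hP _).integrable _)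
      ((bddMeasurable_softV hM hP _).integrable _),
    MDP.integral_transKernel, MDP.integral_transKernel]
  ring

variable [SecondCountableTopology S]

/-- The frozen value function is only a bounded weight in the integral over `s'`; all dependence on
`θ'` runs through the action in `r` and `p`. -/
lemma jointC1_softQ_repar [CompactSpace Ξ] (hM : M.Regular) (hP : P.Regular) (θ : Eu d)
    (k : Fin N) :
    JointC1 fun (x : S × Ξ) θ' => M.softQ α (P.policy θ) x.1 (P.repar θ' x.1 k x.2) := by
  simp_rw [softQ_policy hM hP]
  have hr : JointC1 fun (x : S × Ξ) θ' => M.reward x.1 (P.repar θ' x.1 k x.2) := by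
    refine JointC1.comp_action (g := fun (x : S × Ξ) _ a => M.reward x.1 a) ?_ ?_ ?_
      (hP.jointC1_repar k)
    · exact hM.continuous_reward.comp
        (by fun_prop : Continuous fun y : ((S × Ξ) × Eu d) × A => (y.1.1.1, y.2))
    · exact (JointC1.of_const (g := fun y : (S × Ξ) × A => M.reward y.1.1 y.2)
        (hM.continuous_reward.comp (by fun_prop :
          Continuous fun y : (S × Ξ) × A => (y.1.1, y.2)))).deriv
    · exact hM.deriv_reward.comp (by fun_prop : Continuous fun y : (S × Ξ) × Eu d => y.1.1)
  have hp : JointC1 fun (x : (S × Ξ) × S) θ' =>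
      M.trans x.1.1 (P.repar θ' x.1.1 k x.1.2) x.2 := by
    refine JointC1.comp_action (g := fun (x : (S × Ξ) × S) _ a => M.trans x.1.1 a x.2) ?_ ?_ ?_
      ((hP.jointC1_repar k).comp continuous_fst)
    · exact hM.continuous_trans.comp (by fun_prop :
        Continuous fun y : (((S × Ξ) × S) × Eu d) × A => (y.1.1.1.1, y.2, y.1.1.2))
    · exact (JointC1.of_const (g := fun y : ((S × Ξ) × S) × A => M.trans y.1.1.1 y.2 y.1.2)
        (hM.continuous_trans.comp (by fun_prop :
          Continuous fun y : ((S × Ξ) × S) × A => (y.1.1.1, y.2, y.1.2)))).deriv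
    · exact hM.deriv_trans.comp
        (by fun_prop : Continuous fun y : ((S × Ξ) × S) × Eu d => (y.1.1.1, y.1.2))
  exact hr.add ((hp.integral (bddMeasurable_softV hM hP θ)).const_mul _)

lemma jointC1_mrpIntegrand [CompactSpace Ξ] (hM : M.Regular) (hP : P.Regular)
    (hpos : ∀ θ s a, 0 < (P.policy θ).dens s a) (θ : Eu d) :
    JointC1 fun (x : S × Ξ) θ' => mrpIntegrand M P α θ x.1 x.2 θ' :=
  JointC1.sum Finset.univ fun k _ => ((hP.jointC1_weight k).comp continuous_fst).mul
    ((jointC1_softQ_repar hM hP θ k).sub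
      (((hP.jointC1_dens_repar k).log fun _ _ => hpos _ _ _).const_mul α))

/-- The objective agrees with the average of the marginalized integrand up to second order. -/
lemma objective_sub_isBigO [CompactSpace Ξ] (hM : M.Regular) (hP : P.Regular)
    (hpos : ∀ θ s a, 0 < (P.policy θ).dens s a) (θ : Eu d) :
    (fun θ' => M.objective α (P.policy θ') - M.objective α (P.policy θ)
      - (∫ x : S × Ξ, mrpIntegrand M P α θ x.1 x.2 θ'
          ∂((M.occupancy (P.policy θ)).prod P.noiseMeasure)
        - ∫ x : S × Ξ, mrpIntegrand M P α θ x.1 x.2 θ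
          ∂((M.occupancy (P.policy θ)).prod P.noiseMeasure)))
      =O[nhds θ] fun θ' => ‖θ' - θ‖ ^ 2 := by
  have := M.nonempty_state
  have hg := jointC1_mrpIntegrand (α := α) hM hP hpos θ
  obtain ⟨C, hC0, hC⟩ := hg.exists_lipschitz θ
  obtain ⟨D, hD0, hD⟩ := hP.jointC1_dens.exists_lipschitz θ
  set Φ : Eu d → S → ℝ := fun θ' s => ∫ ε, mrpIntegrand M P α θ s ε θ' ∂P.noiseMeasure with hΦ
  have hgb : ∀ θ', BddMeasurable fun x : S × Ξ => mrpIntegrand M P α θ x.1 x.2 θ' := fun θ' =>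
    .of_continuous (hg.continuous.comp (by fun_prop : Continuous fun x : S × Ξ => (x, θ')))
  have hgs : ∀ θ' s, Integrable (fun ε => mrpIntegrand M P α θ s ε θ') P.noiseMeasure :=
    fun θ' s => ((hgb θ').comp (φ := fun ε => (s, ε)) measurable_prodMk_left).integrable _
  have hΦb : ∀ θ', BddMeasurable (Φ θ') := fun θ' =>
    (hgb θ').integral_kernel_prod_right (Kernel.const S P.noiseMeasure)
  -- For `θ' = θ` the difference of value functions vanishes, so `V_θ` is the fixed point.
  have hΦθ : ∀ s, Φ θ s = M.softV (P.policy θ) α s := fun s => by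
    have := softV_sub_integral_mrpIntegrand (α := α) hM hP hpos θ θ s
    simp only [sub_self, MDP.stateOp, integral_zero, mul_zero] at this
    linarith
  have hdens : ∀ θ' s, BddMeasurable ((P.policy θ').dens s) := fun θ' s =>
    .of_continuous ((hP.continuous_dens θ').comp (by fun_prop : Continuous fun a : A => (s, a)))
  set a := (actionMeasure A).real Set.univ
  set b := (M.occupancy (P.policy θ)).real Set.univ
  -- `D` is a Lipschitz constant for the density, `C / (1 - γ)` bounds `u` relative to `‖θ' - θ‖`,
  -- `a` is the volume of `A`, and `b` is the total mass of the occupancy measure.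
  refine Asymptotics.IsBigO.of_bound (M.disc * (D * (C / (1 - M.disc)) * a) * b) ?_
  filter_upwards [Metric.ball_mem_nhds θ one_pos] with θ' hθ'
  set u : S → ℝ := fun s => M.softV (P.policy θ') α s - M.softV (P.policy θ) α s with hu_def
  have hu : BddMeasurable u := (bddMeasurable_softV hM hP θ').sub (bddMeasurable_softV hM hP θ)
  have hbell : ∀ s, u s - M.disc * M.stateOp (P.policy θ') u s = Φ θ' s - Φ θ s := fun s => by
    have := softV_sub_integral_mrpIntegrand (α := α) hM hP hpos θ θ' s
    rw [hΦθ, ← this]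
    simp only [hu_def, hΦ]
    ring
  have hΦlip : ∀ s, |Φ θ' s - Φ θ s| ≤ C * ‖θ' - θ‖ := fun s => by
    rw [hΦ]
    simp only
    rw [← integral_sub (hgs _ _) (hgs _ _)]
    exact BddMeasurable.abs_integral_le (fun ε => hC (s, ε) θ' hθ') _
  have hub : ∀ s, |u s| ≤ C * ‖θ' - θ‖ / (1 - M.disc) :=
    MDP.abs_le_of_bellman (π := P.policy θ') hu fun s => by rw [hbell]; exact hΦlip s
  -- The occupancy measure of `π_θ` requires the operator of `π_θ`, whereas `hbell` has that of
  -- `π_θ'`; `hfinal` bounds this mismatch.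
  have hJ : M.objective α (P.policy θ') - M.objective α (P.policy θ)
      = ∫ s, (u s - M.disc * M.stateOp (P.policy θ) u s) ∂M.occupancy (P.policy θ) := by
    rw [MDP.integral_occupancy_sub hu, MDP.objective_eq (bddMeasurable_softReward hM hP θ'),
      MDP.objective_eq (bddMeasurable_softReward hM hP θ), integral_sub
        ((bddMeasurable_softV hM hP _).integrable _) ((bddMeasurable_softV hM hP _).integrable _)]
  have hP1 := MDP.bddMeasurable_stateOp (M := M) (π := P.policy θ) hu
  rw [hJ, integral_prod _ ((hgb θ').integrable _), integral_prod _ ((hgb θ).integrable _),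
    ← integral_sub ((hΦb θ').integrable _) ((hΦb θ).integrable _),
    ← integral_sub ((hu.sub (hP1.const_mul _)).integrable _)
      (((hΦb θ').sub (hΦb θ)).integrable _)]
  have hfinal : ∀ s, |u s - M.disc * M.stateOp (P.policy θ) u s - (Φ θ' s - Φ θ s)|
      ≤ M.disc * (D * ‖θ' - θ‖ * (C * ‖θ' - θ‖ / (1 - M.disc)) * a) := fun s => by
    rw [← hbell s]
    have e : u s - M.disc * M.stateOp (P.policy θ) u s
        - (u s - M.disc * M.stateOp (P.policy θ') u s)
        = M.disc * (M.stateOp (P.policy θ') u s - M.stateOp (P.policy θ) u s) := by ring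
    rw [e, abs_mul, abs_of_nonneg M.disc_nonneg]
    exact mul_le_mul_of_nonneg_left (MDP.abs_stateOp_sub_le hu hub (hdens θ s) (hdens θ' s)
      (by positivity) fun a => hD (s, a) θ' hθ') M.disc_nonneg
  rw [Real.norm_eq_abs, Real.norm_of_nonneg (by positivity)]
  refine (abs_integral_le_mul hfinal _).trans (le_of_eq ?_)
  ring

end Mixture

end MixturePG

end

/-! ### The policy gradient formula -/

open MixturePG in
/-- Entropy-regularized marginalized-reparameterization policy gradient theorem. -/
theorem mainTheorem1
    {S : Type*} [TopologicalSpace S] [CompactSpace S] [SecondCountableTopology S]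
    [MeasurableSpace S] [BorelSpace S] (μ : Measure S) [IsFiniteMeasure μ]
    {m : ℕ} (A : Compacts (Eu m)) {l : ℕ} (Ξ : Set (Eu l)) {d N : ℕ}
    (M : MDP S μ A) (P : MixturePolicy S A Ξ d N) (α : ℝ)
    (hM : M.Regular) (hP : P.Regular)
    (hpos : ∀ θ s a, 0 < (P.policy θ).dens s a)
    (θ : Eu d) :
    (∀ s ε, DifferentiableAt ℝ (mrpIntegrand M P α θ s ε) θ) ∧
    Integrable (fun x : S × Ξ => gradient (mrpIntegrand M P α θ x.1 x.2) θ)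
      ((M.occupancy (P.policy θ)).prod P.noiseMeasure) ∧
    HasGradientAt (fun θ' => M.objective α (P.policy θ'))
      (∫ x : S × Ξ, gradient (mrpIntegrand M P α θ x.1 x.2) θ
        ∂((M.occupancy (P.policy θ)).prod P.noiseMeasure)) θ := by
  have := M.nonempty_state
  have := hP.compactSpace_noise
  have hg := jointC1_mrpIntegrand (α := α) hM hP hpos θ
  refine ⟨fun s ε => hg.differentiableAt (s, ε) θ, hg.integrable_gradient _ θ, ?_⟩
  have h1 := (hg.hasGradientAt_integral
    ((M.occupancy (P.policy θ)).prod P.noiseMeasure) θ).hasFDerivAt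
  -- A remainder of order `2 > 1` has derivative zero at `θ`; adding back the averaged integrand and
  -- a constant recovers the objective.
  have h2 := (objective_sub_isBigO (α := α) hM hP hpos θ).hasFDerivAt (𝕜 := ℝ) one_lt_two
  rw [hasGradientAt_iff_hasFDerivAt]
  have h3 := (h2.add h1).add_const (M.objective α (P.policy θ)
    - ∫ x : S × Ξ, mrpIntegrand M P α θ x.1 x.2 θ
        ∂((M.occupancy (P.policy θ)).prod P.noiseMeasure))
  rw [zero_add] at h3
  refine h3.congr_of_eventuallyEq (.of_forall fun θ' => ?_)
  simp only [Pi.add_apply]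
  ring
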